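/- Let $G=(V,E,w)$ be a connected undirected graph with edge weights $w:E\to\mathbb{R}_{\ge 0}$ and shortest-path metric $d_G$. A set $S\subseteq V$ is called $\rho$-independent if $d_G(x,y)>\rho$ for all distinct $x,y\in S$. The local search with swap size $s$ starts with $S=\emptyset$; as long as there is a $\rho$-independent set $S'\subseteq V$ with $|S'|>|S|$ and $|S\setminus S'|+|S'\setminus S|\le s$, it replaces $S$ by such a set $S'$; when there is none, it returns $S$. Theorem. For every $h\in\mathbb{N}$ there are constants $K,T\in\mathbb{N}$ and an algorithm $P$, depending only on $h$, such that the following holds for every graph $H$ on $h$ vertices, every connected weighted $n$-vertex $H$-minor-free graph $G=(V,E,w)$, every $\rho>0$ and every $\epsilon\in(0,\frac12)$. Put $s=\lceil K\epsilon^{-2}\rceil$. 1. Every set $S$ that the local search with swap size $s$ can return (for whatever choice of the improving sets $S'$) is $\rho$-independent and satisfies $|S|\ge(1-\epsilon)|\tilde S|$ for every $\rho$-independent set $\tilde S\subseteq V$. 2. Given $G$, $\rho$ and $\epsilon$ as input, $P$ halts after at most $\max(n,2)^{T\epsilon^{-2}}$ steps and returns an output of the local search with swap size $s$; in particular, it returns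 a $\rho$-independent set $S$ with $|S|\ge(1-\epsilon)|\tilde S|$ for every $\rho$-independent set $\tilde S\subseteq V$. Here algorithms are programs for a real RAM: a random-access machine with natural-number cells (addition, truncated subtraction, comparison, indirect addressing) and real-number cells (exact addition, subtraction, multiplication, comparison), with unit cost per elementary operation; $G$ is given by its adjacency matrix and its weight matrix. -/

import Mathlib

open scoped NNReal

namespace LocalSearch

/-! ### Weighted graphs, shortest-path distance, minors -/

section Graphs

/-- `H` is a minor of `G`: there are pairwise disjoint (nonempty) connected branch sets in `G`, one
for each vertex of `H`, such that the branch sets of adjacent vertices are joined by an edge. -/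
def IsMinor {W V : Type*} (H : SimpleGraph W) (G : SimpleGraph V) : Prop :=
  ∃ B : W → Set V,
    (∀ x, (G.induce (B x)).Connected) ∧
    (∀ x y, x ≠ y → Disjoint (B x) (B y)) ∧
    (∀ x y, H.Adj x y → ∃ u ∈ B x, ∃ v ∈ B y, G.Adj u v)

/-- `G` is `H`-minor-free. -/
def MinorFree {W V : Type*} (H : SimpleGraph W) (G : SimpleGraph V) : Prop :=
  ¬ IsMinor H G

/-- Total weight of a walk. Only the values of `w` at edges of `G` are ever used. -/
def walkWeight {V : Type*} {G : SimpleGraph V} (w : Sym2 V → ℝ≥0) {u v : V}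
    (p : G.Walk u v) : ℝ≥0 :=
  (p.edges.map w).sum

/-- Shortest-path distance of the (connected) weighted graph `(G, w)`. -/
noncomputable def wdist {V : Type*} (G : SimpleGraph V) (w : Sym2 V → ℝ≥0) (u v : V) : ℝ≥0 :=
  ⨅ p : G.Walk u v, walkWeight w p

/-- `S` is `ρ`-independent: distinct points of `S` are at distance greater than `ρ`. -/
def IsIndep {V : Type*} (G : SimpleGraph V) (w : Sym2 V → ℝ≥0) (ρ : ℝ) (S : Finset V) : Prop :=
  ∀ x ∈ S, ∀ y ∈ S, x ≠ y → ρ < (wdist G w x y : ℝ)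

/-- One iteration of the local search: the current set `S` is replaced by a strictly larger
`ρ`-independent set that differs from `S` in at most `s` vertices. -/
def Improves {V : Type*} [DecidableEq V] (G : SimpleGraph V) (w : Sym2 V → ℝ≥0) (ρ : ℝ) (s : ℕ)
    (S S' : Finset V) : Prop :=
  IsIndep G w ρ S' ∧ S.card < S'.card ∧ (S \ S').card + (S' \ S).card ≤ s

/-- `S` is a possible output of the local search with swap size `s`: it is reached from the empty
set by finitely many improving swaps, and no improving swap is left. -/
def IsLocalSearchOutput {V : Type*} [DecidableEq V] (G : SimpleGraph V) (w : Sym2 V → ℝ≥0)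
    (ρ : ℝ) (s : ℕ) (S : Finset V) : Prop :=
  Relation.ReflTransGen (Improves G w ρ s) ∅ S ∧ ∀ S', ¬ Improves G w ρ s S S'

end Graphs

/-! ### Real RAM: structured programs over a random-access memory with integer and real cells -/

section RealRAM

/-- The memory: arrays of natural numbers and arrays of real numbers. A program names its arrays
by constants, so that it uses a fixed finite number of them; the cells of an array are addressed
by computed indices. -/
structure Store where
  nats : ℕ → ℕ → ℕ
  reals : ℕ → ℕ → ℝ

/-- Index arithmetic: constants, array reads, addition and truncated subtraction. -/
inductive NatExpr : Type
  | const (k : ℕ) : NatExpr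
  | read (a : ℕ) (i : NatExpr) : NatExpr
  | add (e f : NatExpr) : NatExpr
  | sub (e f : NatExpr) : NatExpr

def NatExpr.eval (σ : Store) : NatExpr → ℕ
  | .const k => k
  | .read a i => σ.nats a (i.eval σ)
  | .add e f => e.eval σ + f.eval σ
  | .sub e f => e.eval σ - f.eval σ

/-- Number of elementary operations needed to evaluate the expression. -/
def NatExpr.cost : NatExpr → ℕ
  | .const _ => 1
  | .read _ i => i.cost + 1
  | .add e f => e.cost + f.cost + 1
  | .sub e f => e.cost + f.cost + 1

/-- Exact real arithmetic. The only constants are natural numbers; there is no rounding and no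
conversion of real numbers into integers. -/
inductive RealExpr : Type
  | const (k : ℕ) : RealExpr
  | read (a : ℕ) (i : NatExpr) : RealExpr
  | add (e f : RealExpr) : RealExpr
  | sub (e f : RealExpr) : RealExpr
  | mul (e f : RealExpr) : RealExpr

noncomputable def RealExpr.eval (σ : Store) : RealExpr → ℝ
  | .const k => (k : ℝ)
  | .read a i => σ.reals a (i.eval σ)
  | .add e f => e.eval σ + f.eval σ
  | .sub e f => e.eval σ - f.eval σ
  | .mul e f => e.eval σ * f.eval σ

def RealExpr.cost : RealExpr → ℕ
  | .const _ => 1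
  | .read _ i => i.cost + 1
  | .add e f => e.cost + f.cost + 1
  | .sub e f => e.cost + f.cost + 1
  | .mul e f => e.cost + f.cost + 1

inductive Test : Type
  | natLe (e f : NatExpr) : Test
  | realLe (e f : RealExpr) : Test
  | neg (b : Test) : Test
  | conj (b c : Test) : Test

def Test.Holds (σ : Store) : Test → Prop
  | .natLe e f => e.eval σ ≤ f.eval σ
  | .realLe e f => e.eval σ ≤ f.eval σ
  | .neg b => ¬ b.Holds σ
  | .conj b c => b.Holds σ ∧ c.Holds σ

def Test.cost : Test → ℕ
  | .natLe e f => e.cost + f.cost + 1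
  | .realLe e f => e.cost + f.cost + 1
  | .neg b => b.cost + 1
  | .conj b c => b.cost + c.cost + 1

/-- Programs. `setNat a i e` writes the value of `e` into cell `i` of the integer array `a`, and
`setReal` does the same for real arrays. -/
inductive Prog : Type
  | skip : Prog
  | setNat (a : ℕ) (i e : NatExpr) : Prog
  | setReal (a : ℕ) (i : NatExpr) (e : RealExpr) : Prog
  | seq (p q : Prog) : Prog
  | cond (b : Test) (p q : Prog) : Prog
  | loop (b : Test) (p : Prog) : Prog

def Store.writeNat (σ : Store) (a i v : ℕ) : Store :=
  { σ with nats := fun b j => if b = a ∧ j = i then v else σ.nats b j }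

noncomputable def Store.writeReal (σ : Store) (a i : ℕ) (v : ℝ) : Store :=
  { σ with reals := fun b j => if b = a ∧ j = i then v else σ.reals b j }

/-- `Runs p σ τ t`: started in memory `σ`, the program `p` halts in memory `τ` after exactly `t`
elementary steps. (The rules are deterministic.) -/
inductive Runs : Prog → Store → Store → ℕ → Prop
  | skip (σ : Store) : Runs .skip σ σ 1
  | setNat (σ : Store) (a : ℕ) (i e : NatExpr) :
      Runs (.setNat a i e) σ (σ.writeNat a (i.eval σ) (e.eval σ)) (i.cost + e.cost + 1)
  | setReal (σ : Store) (a : ℕ) (i : NatExpr) (e : RealExpr) :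
      Runs (.setReal a i e) σ (σ.writeReal a (i.eval σ) (e.eval σ)) (i.cost + e.cost + 1)
  | seq {p q : Prog} {σ τ υ : Store} {t t' : ℕ} :
      Runs p σ τ t → Runs q τ υ t' → Runs (.seq p q) σ υ (t + t')
  | condTrue {b : Test} {p q : Prog} {σ τ : Store} {t : ℕ} :
      b.Holds σ → Runs p σ τ t → Runs (.cond b p q) σ τ (b.cost + t)
  | condFalse {b : Test} {p q : Prog} {σ τ : Store} {t : ℕ} :
      ¬ b.Holds σ → Runs q σ τ t → Runs (.cond b p q) σ τ (b.cost + t)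
  | loopStop {b : Test} {p : Prog} {σ : Store} :
      ¬ b.Holds σ → Runs (.loop b p) σ σ b.cost
  | loopStep {b : Test} {p : Prog} {σ τ υ : Store} {t t' : ℕ} :
      b.Holds σ → Runs p σ τ t → Runs (.loop b p) τ υ t' → Runs (.loop b p) σ υ (b.cost + t + t')

/-- Row-major listing of an `n × n` table, with `0` beyond the table. -/
def tableEntry {α : Type*} [Zero α] (n : ℕ) (f : Fin n → Fin n → α) (k : ℕ) : α :=
  if hk : k < n * n then
    f ⟨k / n, Nat.div_lt_of_lt_mul hk⟩
      ⟨k % n, Nat.mod_lt k (Nat.pos_of_ne_zero (by rintro rfl; simp at hk))⟩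
  else 0

open Classical in
/-- Initial memory on the input `(G, w)`, `ρ`, `ε`:
integer array `0` holds `n` in cell `0`; integer array `1` is the adjacency matrix of `G`;
real array `0` is the weight matrix (`0` at non-edges); real array `1` holds `ρ` in cell `0` and
`ε` in cell `1`. Every other cell is `0`. -/
noncomputable def inputStore (n : ℕ) (G : SimpleGraph (Fin n)) (w : Sym2 (Fin n) → ℝ≥0)
    (ρ ε : ℝ) : Store where
  nats a k :=
    if a = 0 ∧ k = 0 then n
    else if a = 1 then tableEntry n (fun u v => if G.Adj u v then 1 else 0) k
    else 0
  reals a k :=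
    if a = 0 then tableEntry n (fun u v => if G.Adj u v then (w s(u, v) : ℝ) else 0) k
    else if a = 1 ∧ k = 0 then ρ
    else if a = 1 ∧ k = 1 then ε
    else 0

/-- The vertex set returned by a program: the vertices `v` whose cell of integer array `2`
is `1`. -/
def outputSet (n : ℕ) (σ : Store) : Finset (Fin n) :=
  Finset.univ.filter fun v => σ.nats 2 v = 1

end RealRAM

end LocalSearch

/-! Approximation. Compare a local optimum `L` with any independent set `O`. After a small
perturbation making all weights positive, form the Voronoi cells of `L ∪ O` and contract them. The
resulting exchange graph is a minor of `G`, hence has no `K_h` minor. If `x ∈ L` and `y ∈ O` are in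
conflict, then by independence of `L` and of `O` a geodesic between them stays in the cells of `x`
and `y`, so `x` and `y` are adjacent in the exchange graph (`exists_exchange_graph`).

Graphs without a `K_h` minor have separators of size `O(√n)` (`exists_separator`). Recursive
splitting yields pieces of size at most `q ^ 2` that cover all edges, with total overlap `O(n / q)`
(`exists_division`). Inside one piece, exchange the elements of `L` for those elements of `O` that
lie in no other piece. No conflict can leave the piece, so the result is independent; local
optimality says that it is no larger than `L`. Summing over the pieces shows that `L` is smaller
than `O` by at most twice the overlap (`card_le_of_division`). With `q` of order `1 / ε` the overlap
is at most `ε |O| / 2`, and the swap size is of order `1 / ε ^ 2`.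

Algorithm. A swap of at most `s` vertices is the set of base-`n` digits of a code below `n ^ s`. The
program tabulates truncated distances, tries the codes in turn, and starts over after each
improvement. There are at most `n` improvements, so everything is polynomial in a common bound on
`n`, `s` and `n ^ s`. The running time is therefore recorded only as an exponent of such a bound
(`Within`), which becomes `max n 2 ^ (s + 1)` at the end. -/

namespace LocalSearch

/-! ### Connected vertex sets -/

section Connectivity

variable {V : Type*}

/-- A step along an edge inside the vertex set `S`. -/
def StepIn (G : SimpleGraph V) (S : Set V) (a b : V) : Prop :=
  G.Adj a b ∧ a ∈ S ∧ b ∈ S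

/-- `b` can be reached from `a` along edges inside `S`. -/
abbrev ReachIn (G : SimpleGraph V) (S : Set V) : V → V → Prop :=
  Relation.ReflTransGen (StepIn G S)

/-- `S` is nonempty and induces a connected subgraph. -/
def ConnOn (G : SimpleGraph V) (S : Set V) : Prop :=
  S.Nonempty ∧ ∀ u ∈ S, ∀ v ∈ S, ReachIn G S u v

variable {G : SimpleGraph V} {S T : Set V} {a b : V}

theorem StepIn.symm (h : StepIn G S a b) : StepIn G S b a :=
  ⟨h.1.symm, h.2.2, h.2.1⟩

theorem ReachIn.symm (h : ReachIn G S a b) : ReachIn G S b a := by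
  induction h with
  | refl => exact .refl
  | tail _ h ih => exact .head h.symm ih

theorem ReachIn.mono (hST : S ⊆ T) (h : ReachIn G S a b) : ReachIn G T a b :=
  Relation.ReflTransGen.mono (fun _ _ h => ⟨h.1, hST h.2.1, hST h.2.2⟩) _ _ h

theorem ReachIn.mem (h : ReachIn G S a b) (ha : a ∈ S) : b ∈ S := by
  cases h with
  | refl => exact ha
  | tail _ h => exact h.2.2

theorem connOn_iff : ConnOn G S ↔ (G.induce S).Connected := by
  constructor
  · rintro ⟨⟨x, hx⟩, h⟩
    have : Nonempty S := ⟨⟨x, hx⟩⟩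
    refine ⟨?_⟩
    rintro ⟨u, hu⟩ ⟨v, hv⟩
    have key : ∀ v, ReachIn G S u v → ∀ hv : v ∈ S,
        (G.induce S).Reachable ⟨u, hu⟩ ⟨v, hv⟩ := by
      intro v hr
      induction hr with
      | refl => intro _; exact .refl _
      | tail _ h ih =>
        intro hv
        exact (ih h.2.1).trans (SimpleGraph.Adj.reachable (by simpa using h.1))
    exact key v (h u hu v hv) hv
  · intro h
    obtain ⟨⟨x, hx⟩⟩ := h.nonempty
    refine ⟨⟨x, hx⟩, fun u hu v hv => ?_⟩
    have := (SimpleGraph.reachable_iff_reflTransGen _ _).1 (h.preconnected ⟨u, hu⟩ ⟨v, hv⟩)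
    exact Relation.ReflTransGen.lift (fun x : S => (x : V))
      (fun a b hab => ⟨by simpa using hab, a.2, b.2⟩) _ _ this

theorem connOn_singleton (v : V) : ConnOn G {v} :=
  ⟨⟨v, rfl⟩, by rintro _ rfl _ rfl; exact .refl⟩

/-- A set all of whose vertices can be linked to a connected core is connected. -/
theorem ConnOn.of_core (hS : ConnOn G S) (hST : S ⊆ T)
    (h : ∀ v ∈ T, ∃ u ∈ S, ReachIn G T v u) : ConnOn G T := by
  refine ⟨hS.1.mono hST, fun u hu v hv => ?_⟩
  obtain ⟨a, ha, hua⟩ := h u hu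
  obtain ⟨b, hb, hvb⟩ := h v hv
  exact hua.trans (((hS.2 a ha b hb).mono hST).trans hvb.symm)

theorem ConnOn.insert (hS : ConnOn G S) (ha : a ∈ S) (hab : G.Adj a b) :
    ConnOn G (insert b S) := by
  refine hS.of_core (Set.subset_insert _ _) fun v hv => ?_
  rcases hv with rfl | hv
  · exact ⟨a, ha, .single ⟨hab.symm, Set.mem_insert _ _, Set.mem_insert_of_mem _ ha⟩⟩
  · exact ⟨v, hv, .refl⟩

/-- A connected set that meets `B` and avoids the boundary of `B` lies in `B`. -/
theorem ConnOn.subset_of_closed {B X : Set V} (hS : ConnOn G S) (hX : Disjoint S X)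
    (hB : ∀ v ∈ B, ∀ u, G.Adj v u → u ∈ B ∨ u ∈ X) (ha : a ∈ S) (haB : a ∈ B) : S ⊆ B := by
  intro v hv
  have h := hS.2 a ha v hv
  induction h with
  | refl => exact haB
  | tail _ h ih =>
    exact (hB _ (ih h.2.1) _ h.1).resolve_right fun hx => Set.disjoint_left.1 hX h.2.2 hx

end Connectivity

/-! ### Separators in graphs without a complete minor -/

section Separator

variable {V : Type*} [Fintype V] {G : SimpleGraph V}

open Classical in
/-- Breadth-first layers in a stack of `h` copies of `G[B]`, where one climbs from copy `i` to
copy `i + 1` at the vertices of `A (i + 1)`. -/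
noncomputable def stackBall (G : SimpleGraph V) (B : Set V) {h : ℕ} (A : Fin h → Set V) :
    ℕ → Finset (V × Fin h)
  | 0 => ∅
  | 1 => Finset.univ.filter fun x => x.2.val = 0 ∧ x.1 ∈ A x.2
  | d + 2 => Finset.univ.filter fun y => y ∈ stackBall G B A (d + 1) ∨
      ∃ x ∈ stackBall G B A (d + 1), (x.2 = y.2 ∧ StepIn G B x.1 y.1) ∨
        (x.1 = y.1 ∧ x.2.val + 1 = y.2.val ∧ y.1 ∈ A y.2)

theorem stackBall_mono (B : Set V) {h : ℕ} (A : Fin h → Set V) :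
    Monotone (stackBall G B A) := by
  refine monotone_nat_of_le_succ fun d => ?_
  match d with
  | 0 => simp [stackBall]
  | d + 1 =>
    intro x hx
    simp only [stackBall, Finset.mem_filter, Finset.mem_univ, true_and]
    exact Or.inl hx

-- A copy can be entered from the one below only at a vertex of its own `A i`. The vertices on a
-- route from the bottom copy to `x` thus project to a connected set that meets every `A i` on the
-- way. A step inside a copy adds at most one vertex and a climb adds none, so the size is bounded
-- by the number of layers.
open Classical in
theorem stackBall_tree {B : Set V} {h : ℕ} {A : Fin h → Set V} (hA : ∀ i, A i ⊆ B) (d : ℕ)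
    (x : V × Fin h) (hx : x ∈ stackBall G B A d) :
    ∃ T : Finset V, (T : Set V) ⊆ B ∧ T.card ≤ d ∧ x.1 ∈ T ∧ ConnOn G T ∧
      ∀ i ≤ x.2, ∃ v ∈ T, v ∈ A i := by
  induction d generalizing x with
  | zero => simp [stackBall] at hx
  | succ d ih =>
    match d with
    | 0 =>
      simp only [stackBall, Finset.mem_filter, Finset.mem_univ, true_and] at hx
      refine ⟨{x.1}, by simpa using hA _ hx.2, by simp, by simp,
        by simpa using connOn_singleton x.1, fun i hi => ⟨x.1, by simp, ?_⟩⟩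
      have : i = x.2 := by
        apply Fin.ext
        have := Fin.le_def.1 hi
        omega
      rw [this]; exact hx.2
    | d + 1 =>
      simp only [stackBall, Finset.mem_filter, Finset.mem_univ, true_and] at hx
      rcases hx with hx | ⟨y, hy, hxy⟩
      · obtain ⟨T, h1, h2, h3⟩ := ih x hx
        exact ⟨T, h1, by omega, h3⟩
      obtain ⟨T, h1, h2, h3, h4, h5⟩ := ih y hy
      rcases hxy with ⟨e, hs⟩ | ⟨e, e2, hs⟩
      · refine ⟨insert x.1 T, ?_, (Finset.card_insert_le _ _).trans (by omega), by simp, ?_, ?_⟩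
        · rw [Finset.coe_insert]
          exact Set.insert_subset hs.2.2 h1
        · rw [Finset.coe_insert]
          exact h4.insert (by exact_mod_cast h3) hs.1
        · rintro i hi
          obtain ⟨v, hv, hvi⟩ := h5 i (by rw [e]; exact hi)
          exact ⟨v, by simp [hv], hvi⟩
      · refine ⟨T, h1, by omega, by rwa [← e], h4, fun i hi => ?_⟩
        by_cases hi' : i ≤ y.2
        · exact h5 i hi'
        · have : i = x.2 := by
            apply Fin.ext
            have := Fin.le_def.1 hi
            rw [Fin.le_def] at hi'
            omega
          exact ⟨x.1, by rwa [← e], by rw [this]; exact hs⟩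

/-- The `r` successive differences are disjoint, so one of them has at most the average size. -/
theorem exists_small_layer {J : Type*} [Fintype J] [DecidableEq J] (f : ℕ → Finset J)
    (hf : Monotone f) {r : ℕ} (hr : 0 < r) :
    ∃ d < r, (f (d + 1) \ f d).card * r ≤ Fintype.card J := by
  by_contra! hcon
  have hsum : ∀ r, ∑ d ∈ Finset.range r, (f (d + 1) \ f d).card ≤ (f r).card := by
    intro r
    induction r with
    | zero => simp
    | succ r ih =>
      rw [Finset.sum_range_succ, Finset.card_sdiff_of_subset (hf (Nat.le_succ r))]
      have := Finset.card_le_card (hf (Nat.le_succ r))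
      simp only [Nat.succ_eq_add_one] at *
      omega
  have h1 : ∑ d ∈ Finset.range r, Fintype.card J
      < ∑ d ∈ Finset.range r, (f (d + 1) \ f d).card * r :=
    Finset.sum_lt_sum_of_nonempty (by simpa using hr.ne')
      fun d hd => hcon d (Finset.mem_range.1 hd)
  rw [← Finset.sum_mul, Finset.sum_const, Finset.card_range, smul_eq_mul, mul_comm] at h1
  have h2 := (hsum r).trans (Finset.card_le_univ _)
  exact absurd (lt_of_mul_lt_mul_right h1 (Nat.zero_le r)) (not_lt.2 h2)

open Classical in
/-- Either a small tree in `B` meets all the sets `A i`, or a small set cuts `B` into connected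
parts each of which misses one of them. -/
theorem exists_tree_or_cut (G : SimpleGraph V) (B : Set V) {h r : ℕ} (hh : 0 < h) (hr : 0 < r)
    (A : Fin h → Set V) (hA : ∀ i, A i ⊆ B) :
    (∃ T : Finset V, (T : Set V) ⊆ B ∧ T.card ≤ r ∧ ConnOn G T ∧ ∀ i, ∃ v ∈ T, v ∈ A i) ∨
    (∃ Z : Finset V, Z.card * r ≤ h * Fintype.card V ∧
      ∀ D : Set V, ConnOn G D → D ⊆ B → Disjoint D Z → ∃ i, ∀ v ∈ D, v ∉ A i) := by
  -- If the top copy is reached within `r` layers, a route to it gives the tree. Otherwise a thin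
  -- layer, projected to `V`, is the cut.
  by_cases hlast : ∃ v, (v, (⟨h - 1, by omega⟩ : Fin h)) ∈ stackBall G B A r
  · obtain ⟨v, hv⟩ := hlast
    obtain ⟨T, h1, h2, -, h4, h5⟩ := stackBall_tree hA r _ hv
    refine Or.inl ⟨T, h1, h2, h4, fun i => h5 i ?_⟩
    have := i.2
    rw [Fin.le_def]
    simp only
    omega
  push Not at hlast
  obtain ⟨d, hd, hcard⟩ := exists_small_layer (stackBall G B A) (stackBall_mono B A) hr
  refine Or.inr ⟨(stackBall G B A (d + 1) \ stackBall G B A d).image Prod.fst, ?_, ?_⟩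
  · refine (Nat.mul_le_mul_right _ Finset.card_image_le).trans (hcard.trans ?_)
    rw [Fintype.card_prod, Fintype.card_fin, mul_comm]
  intro D hD hDB hdis
  -- A connected `D` that avoids the thin layer and meets every `A i` is swallowed by the ball copy
  -- after copy, so that the top copy would be reached after all.
  by_contra! hmeet
  have havoid : ∀ x : V × Fin h, x.1 ∈ D → x ∈ stackBall G B A (d + 1) → x ∈ stackBall G B A d := by
    intro x hxD hx
    by_contra hx'
    exact Set.disjoint_left.1 hdis hxD
      (by exact_mod_cast Finset.mem_image_of_mem Prod.fst (Finset.mem_sdiff.2 ⟨hx, hx'⟩))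
  have hstep : ∀ x y : V × Fin h, x ∈ stackBall G B A d → y.1 ∈ D →
      ((x.2 = y.2 ∧ StepIn G B x.1 y.1) ∨ (x.1 = y.1 ∧ x.2.val + 1 = y.2.val ∧ y.1 ∈ A y.2)) →
      y ∈ stackBall G B A d := by
    intro x y hx hy hxy
    apply havoid y hy
    match d, hx with
    | d + 1, hx =>
      rw [stackBall]
      simp only [Finset.mem_filter, Finset.mem_univ, true_and]
      exact Or.inr ⟨x, hx, hxy⟩
  have hspread : ∀ (i : Fin h) (a : V), a ∈ D → (a, i) ∈ stackBall G B A d →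
      ∀ u ∈ D, (u, i) ∈ stackBall G B A d := by
    intro i a ha hai u hu
    have hr := hD.2 a ha u hu
    induction hr with
    | refl => exact hai
    | tail _ h ih => exact hstep _ _ (ih h.2.1) hu (Or.inl ⟨rfl, h.1, hDB h.2.1, hDB h.2.2⟩)
  have hall : ∀ (k : ℕ) (hk : k < h), ∀ u ∈ D, (u, (⟨k, hk⟩ : Fin h)) ∈ stackBall G B A d := by
    intro k
    induction k with
    | zero =>
      intro hk
      obtain ⟨a, ha, haA⟩ := hmeet ⟨0, hk⟩
      -- Ball `1` is the set of starting points and ball `0` is empty. Hence for `d = 0` the thin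
      -- layer is `A 0` itself, and this case needs no separate treatment.
      refine hspread _ a ha (havoid _ ha (stackBall_mono B A (Nat.le_add_left 1 d) ?_))
      simp [stackBall, haA]
    | succ k ih =>
      intro hk
      obtain ⟨a, ha, haA⟩ := hmeet ⟨k + 1, hk⟩
      exact hspread _ a ha (hstep _ _ (ih (by omega) a ha) ha (Or.inr ⟨rfl, rfl, haA⟩))
  obtain ⟨u, hu⟩ := hD.1
  exact hlast u (stackBall_mono B A hd.le (hall (h - 1) (by omega) u hu))

/-- A partial complete minor `C i`, `i ∈ I`, with small subsets `X i` of the branch sets that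
separate the remaining majority part `B` from the rest of the graph. -/
structure Covey (G : SimpleGraph V) (h t : ℕ) (I : Finset (Fin h)) (C X : Fin h → Set V)
    (B : Set V) : Prop where
  conn : ∀ i ∈ I, ConnOn G (C i)
  disj : ∀ i ∈ I, ∀ j ∈ I, i ≠ j → Disjoint (C i) (C j)
  adj : ∀ i ∈ I, ∀ j ∈ I, i ≠ j → ∃ u ∈ C i, ∃ v ∈ C j, G.Adj u v
  sub : ∀ i ∈ I, X i ⊆ C i
  card_le : ∀ i ∈ I, (X i).ncard ≤ t
  connB : ConnOn G B
  heavy : Fintype.card V < 2 * B.ncard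
  disjB : ∀ i ∈ I, Disjoint (C i) B
  closed : ∀ v ∈ B, ∀ u, G.Adj v u → u ∈ B ∨ ∃ i ∈ I, u ∈ X i


theorem ncard_iUnion_le {ι W : Type*} (I : Finset ι) (X : ι → Set W) {t : ℕ}
    (h : ∀ i ∈ I, (X i).ncard ≤ t) : (⋃ i ∈ I, X i).ncard ≤ I.card * t := by
  classical
  induction I using Finset.induction_on with
  | empty => simp
  | insert a s ha ih =>
    rw [Finset.set_biUnion_insert, Finset.card_insert_of_notMem ha, add_mul, one_mul, add_comm]
    exact (Set.ncard_union_le _ _).trans (Nat.add_le_add (h a (by simp))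
      (ih fun i hi => h i (by simp [hi])))

-- Three moves push the potential down. A branch set with no neighbour in `B` is dropped. A small
-- tree in `B` touching all branch sets becomes a new branch set. A small cut `Z` leaves a majority
-- part `B₁` that misses the neighbours of some `C i`, and then the parts of `B` attached to `C i`
-- are absorbed into it. The number of branch sets cannot reach `h`, since this would be a `K_h`
-- minor.
open Classical in
theorem Covey.exists_smaller {h t : ℕ} (ht : 0 < t) (hn : h * Fintype.card V ≤ t * t)
    (hminor : ¬ IsMinor (⊤ : SimpleGraph (Fin h)) G)
    (hsep : ∀ X : Set V, X.ncard ≤ h * t → ∃ B : Set V, ConnOn G B ∧ Disjoint B X ∧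
      (∀ v ∈ B, ∀ u, G.Adj v u → u ∈ B ∨ u ∈ X) ∧ Fintype.card V < 2 * B.ncard)
    {I : Finset (Fin h)} {C X : Fin h → Set V} {B : Set V} (hC : Covey G h t I C X B) :
    ∃ I' C' X' B', Covey G h t I' C' X' B' ∧
      B'.ncard * (h + 1) + I'.card < B.ncard * (h + 1) + I.card := by
  -- The factor `h + 1` makes the loss of a single vertex of `B` outweigh any growth of `I`, which
  -- has at most `h` elements.
  have hsmall : ∀ B' : Set V, B' ⊂ B → ∀ I' : Finset (Fin h),
      B'.ncard * (h + 1) + I'.card < B.ncard * (h + 1) + I.card := by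
    intro B' hB' I'
    have h1 := Set.ncard_lt_ncard hB' (Set.toFinite _)
    have h2 : I'.card ≤ h := by simpa using Finset.card_le_univ I'
    nlinarith
  have hI : ∃ j, j ∉ I := by
    by_contra! hI
    refine hminor ⟨C, fun x => connOn_iff.1 (hC.conn x (hI x)),
      fun x y hxy => hC.disj x (hI x) y (hI y) hxy,
      fun x y hxy => hC.adj x (hI x) y (hI y) (by simpa using hxy)⟩
  obtain ⟨j, hj⟩ := hI
  have hIcard : I.card + 1 ≤ h := by
    have := Finset.card_le_univ (insert j I)
    rwa [Finset.card_insert_of_notMem hj, Fintype.card_fin] at this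
  have hBX : Disjoint B (⋃ i ∈ I, X i) := by
    rw [Set.disjoint_left]
    intro v hv hvX
    simp only [Set.mem_iUnion] at hvX
    obtain ⟨i, hi, hvX⟩ := hvX
    exact Set.disjoint_left.1 (hC.disjB i hi) (hC.sub i hi hvX) hv
  have hclosed : ∀ v ∈ B, ∀ u, G.Adj v u → u ∈ B ∨ u ∈ ⋃ i ∈ I, X i := by
    intro v hv u huv
    simpa using hC.closed v hv u huv
  -- the majority part left by a slightly larger separator lies in `B`
  have hcut : ∀ Z : Set V, Z.ncard ≤ t → ∃ B₁ : Set V, ConnOn G B₁ ∧ Disjoint B₁ Z ∧ B₁ ⊆ B ∧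
      (∀ v ∈ B₁, ∀ u, G.Adj v u → u ∈ B₁ ∨ (∃ i ∈ I, u ∈ X i) ∨ u ∈ Z) ∧
      Fintype.card V < 2 * B₁.ncard := by
    intro Z hZ
    -- Since `|I| + 1 ≤ h`, there is room for `t` more vertices. The new majority part meets `B`, as
    -- both have more than half of the vertices, and it cannot cross the boundary of `B`.
    obtain ⟨B₁, h1, h2, h3, h4⟩ := hsep ((⋃ i ∈ I, X i) ∪ Z) (by
      refine (Set.ncard_union_le _ _).trans ?_
      have := ncard_iUnion_le I X hC.card_le
      nlinarith)
    rw [Set.disjoint_union_right] at h2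
    have hmeet : ∃ a ∈ B₁, a ∈ B := by
      by_contra! hcon
      have hd : Disjoint B₁ B := Set.disjoint_left.2 hcon
      have h5 := Set.ncard_union_eq hd (Set.toFinite _) (Set.toFinite _)
      have h6 : (B₁ ∪ B).ncard ≤ Fintype.card V := by
        rw [← Nat.card_eq_fintype_card]
        exact Set.ncard_le_card _
      have := hC.heavy
      omega
    obtain ⟨a, ha, haB⟩ := hmeet
    refine ⟨B₁, h1, h2.2, h1.subset_of_closed h2.1 hclosed ha haB, ?_, h4⟩
    intro v hv u huv
    simpa [or_assoc] using h3 v hv u huv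
  -- For `i ∉ I` the condition is void and `A i = B`: every tree in `B` meets it and no nonempty
  -- part of `B` misses it.
  set A : Fin h → Set V := fun i => {v | v ∈ B ∧ (i ∈ I → ∃ u ∈ C i, G.Adj v u)} with hAdef
  by_cases hempty : ∃ i ∈ I, A i = ∅
  · obtain ⟨i, hi, hAi⟩ := hempty
    have hno : ∀ v ∈ B, ∀ u ∈ C i, ¬ G.Adj v u := by
      intro v hv u hu huv
      have : v ∈ A i := ⟨hv, fun _ => ⟨u, hu, huv⟩⟩
      rw [hAi] at this
      exact this
    refine ⟨I.erase i, C, X, B, ?_, ?_⟩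
    · have hsub : ∀ k ∈ I.erase i, k ∈ I := fun k hk => Finset.mem_of_mem_erase hk
      refine ⟨fun k hk => hC.conn k (hsub k hk), fun k hk l hl => hC.disj k (hsub k hk) l (hsub l hl),
        fun k hk l hl => hC.adj k (hsub k hk) l (hsub l hl), fun k hk => hC.sub k (hsub k hk),
        fun k hk => hC.card_le k (hsub k hk), hC.connB, hC.heavy,
        fun k hk => hC.disjB k (hsub k hk), ?_⟩
      intro v hv u huv
      refine (hC.closed v hv u huv).imp_right ?_
      rintro ⟨k, hk, huk⟩
      refine ⟨k, Finset.mem_erase.2 ⟨?_, hk⟩, huk⟩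
      rintro rfl
      exact hno v hv u (hC.sub k hk huk) huv
    · rw [Finset.card_erase_of_mem hi]
      have := Finset.card_pos.2 ⟨i, hi⟩
      omega
  push Not at hempty
  rcases exists_tree_or_cut G B (Nat.pos_of_ne_zero (by rintro rfl; exact j.elim0)) ht A
    (fun i v hv => hv.1) with ⟨T, hTB, hTt, hTc, hTA⟩ | ⟨Z, hZt, hZ⟩
  · obtain ⟨B₁, h1, h2, h3, h4, h5⟩ := hcut T (by simpa using hTt)
    have hne : ∀ i ∈ I, i ≠ j := fun i hi e => hj (e ▸ hi)
    have hadj : ∀ i ∈ I, ∃ u ∈ C i, ∃ v ∈ (T : Set V), G.Adj u v := by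
      intro i hi
      obtain ⟨v, hv, hvA⟩ := hTA i
      obtain ⟨u, hu, huv⟩ := hvA.2 hi
      exact ⟨u, hu, v, hv, huv.symm⟩
    -- The whole tree serves as its own boundary `X j`, having at most `t` vertices.
    refine ⟨insert j I, Function.update C j T, Function.update X j T, B₁, ?_, hsmall _ ?_ _⟩
    · constructor
      · intro i hi
        rcases Finset.mem_insert.1 hi with rfl | hi
        · simpa using hTc
        · simpa [hne i hi] using hC.conn i hi
      · intro i hi k hk hik
        rcases Finset.mem_insert.1 hi with hi' | hi' <;> rcases Finset.mem_insert.1 hk with hk' | hk'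
        · exact absurd (hi'.trans hk'.symm) hik
        · subst hi'
          simpa [hne k hk'] using (hC.disjB k hk').symm.mono_left hTB
        · subst hk'
          simpa [hne i hi'] using (hC.disjB i hi').mono_right hTB
        · simpa [hne i hi', hne k hk'] using hC.disj i hi' k hk' hik
      · intro i hi k hk hik
        rcases Finset.mem_insert.1 hi with hi' | hi' <;> rcases Finset.mem_insert.1 hk with hk' | hk'
        · exact absurd (hi'.trans hk'.symm) hik
        · subst hi'
          obtain ⟨u, hu, v, hv, huv⟩ := hadj k hk'
          simp only [Function.update_self, Function.update_of_ne (hne k hk')]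
          exact ⟨v, hv, u, hu, huv.symm⟩
        · subst hk'
          simp only [Function.update_self, Function.update_of_ne (hne i hi')]
          exact hadj i hi'
        · simpa [hne i hi', hne k hk'] using hC.adj i hi' k hk' hik
      · intro i hi
        rcases Finset.mem_insert.1 hi with rfl | hi
        · simp
        · simpa [hne i hi] using hC.sub i hi
      · intro i hi
        rcases Finset.mem_insert.1 hi with rfl | hi
        · simpa using hTt
        · simpa [hne i hi] using hC.card_le i hi
      · exact h1
      · exact h5
      · intro i hi
        rcases Finset.mem_insert.1 hi with rfl | hi
        · simpa using h2.symm
        · simpa [hne i hi] using (hC.disjB i hi).mono_right h3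
      · intro v hv u huv
        rcases h4 v hv u huv with hu | ⟨i, hi, hu⟩ | hu
        · exact Or.inl hu
        · exact Or.inr ⟨i, by simp [hi], by simpa [hne i hi] using hu⟩
        · exact Or.inr ⟨j, by simp, by simpa using hu⟩
    · refine ⟨h3, fun hBB => ?_⟩
      obtain ⟨a, ha⟩ := hTc.1
      exact Set.disjoint_left.1 h2 (hBB (hTB ha)) ha
  · have hZcard : Z.card ≤ t := by
      have := hZt.trans hn
      exact Nat.le_of_mul_le_mul_right this ht
    obtain ⟨B₁, h1, h2, h3, h4, h5⟩ := hcut Z (by simpa using hZcard)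
    obtain ⟨i, hiA⟩ := hZ B₁ h1 h3 h2
    have hi : i ∈ I := by
      by_contra hi
      obtain ⟨a, ha⟩ := h1.1
      exact hiA a ha ⟨h3 ha, fun h => absurd h hi⟩
    -- the part of `B \ B₁` that is attached to `C i`
    set R : Set V := {v | v ∈ B \ B₁ ∧ ∃ a ∈ A i, a ∈ B \ B₁ ∧ ReachIn G (B \ B₁) a v} with hR
    have hRstep : ∀ v ∈ B \ B₁, ∀ u ∈ R, G.Adj v u → v ∈ R := by
      rintro v hv u ⟨hu, a, ha, ha', hau⟩ huv
      exact ⟨hv, a, ha, ha', hau.tail ⟨huv.symm, hu, hv⟩⟩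
    have hRB : R ⊆ B := fun v hv => hv.1.1
    have hB₁R : B₁ ⊆ B \ R := fun v hv => ⟨h3 hv, fun hvR => hvR.1.2 hv⟩
    have hconnR : ConnOn G (C i ∪ R) := by
      refine (hC.conn i hi).of_core Set.subset_union_left ?_
      rintro v (hv | ⟨hv, a, ha, ha', hav⟩)
      · exact ⟨v, hv, .refl⟩
      obtain ⟨u, hu, hau⟩ := ha.2 hi
      have hreach : ReachIn G (C i ∪ R) a v := by
        have : ∀ w, ReachIn G (B \ B₁) a w → ReachIn G (C i ∪ R) a w := by
          intro w hw
          induction hw with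
          | refl => exact .refl
          | tail hab hbc ih =>
            exact ih.tail ⟨hbc.1, Or.inr ⟨hbc.2.1, a, ha, ha', hab⟩,
              Or.inr ⟨hbc.2.2, a, ha, ha', hab.tail hbc⟩⟩
        exact this v hav
      exact ⟨u, hu, hreach.symm.tail ⟨hau, Or.inr ⟨ha', a, ha, ha', .refl⟩, Or.inl hu⟩⟩
    have hconnB : ConnOn G (B \ R) := by
      refine h1.of_core hB₁R ?_
      rintro v ⟨hv, hvR⟩
      obtain ⟨b, hb⟩ := h1.1
      have hvb := hC.connB.2 v hv b (h3 hb)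
      induction hvb using Relation.ReflTransGen.head_induction_on with
      | refl => exact ⟨b, hb, .refl⟩
      | @head v w hvw _ ih =>
        by_cases hvB₁ : v ∈ B₁
        · exact ⟨v, hvB₁, .refl⟩
        have hwR : w ∉ R := fun hw => hvR (hRstep v ⟨hv, hvB₁⟩ w hw hvw.1)
        obtain ⟨u, hu, hwu⟩ := ih hvw.2.2 hwR
        exact ⟨u, hu, hwu.head ⟨hvw.1, ⟨hv, hvR⟩, hvw.2.2, hwR⟩⟩
    -- The old `X i` can be forgotten: all neighbours of `C i` in `B` avoid `B₁` and hence lie in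
    -- `R`. An edge from `B \ R` into `R` must start in `B₁` and so end in `Z`. This makes `Z ∩ R` a
    -- valid new boundary.
    refine ⟨I, Function.update C i (C i ∪ R), Function.update X i (Z ∩ R), B \ R, ?_,
      hsmall _ ?_ _⟩
    · constructor
      · intro k hk
        by_cases hki : k = i
        · subst hki; simpa using hconnR
        · simpa [hki] using hC.conn k hk
      · intro k hk l hl hkl
        by_cases hki : k = i
        · subst hki
          simpa [hkl.symm] using ⟨hC.disj k hk l hl hkl, (hC.disjB l hl).symm.mono_left hRB⟩
        · by_cases hli : l = i
          · subst hli
            simpa [hkl] using ⟨hC.disj k hk l hl hkl, (hC.disjB k hk).mono_right hRB⟩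
          · simpa [hki, hli] using hC.disj k hk l hl hkl
      · intro k hk l hl hkl
        obtain ⟨u, hu, v, hv, huv⟩ := hC.adj k hk l hl hkl
        refine ⟨u, ?_, v, ?_, huv⟩
        · by_cases hki : k = i
          · subst hki; simp [hu]
          · simpa [hki] using hu
        · by_cases hli : l = i
          · subst hli; simp [hv]
          · simpa [hli] using hv
      · intro k hk
        by_cases hki : k = i
        · subst hki
          simpa using Set.inter_subset_right.trans Set.subset_union_right
        · simpa [hki] using hC.sub k hk
      · intro k hk
        by_cases hki : k = i
        · subst hki
          simpa using (Set.ncard_le_ncard Set.inter_subset_left (Set.toFinite _)).trans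
            (by simpa using hZcard)
        · simpa [hki] using hC.card_le k hk
      · exact hconnB
      · have := Set.ncard_le_ncard hB₁R (Set.toFinite _)
        omega
      · intro k hk
        by_cases hki : k = i
        · subst hki
          simpa using ⟨(hC.disjB k hk).mono_right Set.sdiff_subset, Set.disjoint_sdiff_right⟩
        · simpa [hki] using (hC.disjB k hk).mono_right Set.sdiff_subset
      · rintro v ⟨hv, hvR⟩ u huv
        rcases hC.closed v hv u huv with hu | ⟨k, hk, hu⟩
        · by_cases huR : u ∈ R
          · have hvB₁ : v ∈ B₁ := by
              by_contra hvB₁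
              exact hvR (hRstep v ⟨hv, hvB₁⟩ u huR huv)
            rcases h4 v hvB₁ u huv with hu' | ⟨k, hk, hu'⟩ | hu'
            · exact absurd hu' huR.1.2
            · exact absurd hu (Set.disjoint_left.1 (hC.disjB k hk) (hC.sub k hk hu'))
            · exact Or.inr ⟨i, hi, by simpa using ⟨hu', huR⟩⟩
          · exact Or.inl ⟨hu, huR⟩
        · by_cases hki : k = i
          · subst hki
            exfalso
            have hvA : v ∈ A k := ⟨hv, fun _ => ⟨u, hC.sub k hk hu, huv⟩⟩
            have hvB₁ : v ∉ B₁ := fun h => hiA v h hvA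
            exact hvR ⟨⟨hv, hvB₁⟩, v, hvA, ⟨hv, hvB₁⟩, .refl⟩
          · exact Or.inr ⟨k, hk, by simpa [hki] using hu⟩
    · obtain ⟨a, ha⟩ := hempty i hi
      have haB₁ : a ∉ B₁ := fun h => hiA a h ha
      refine ⟨Set.sdiff_subset, fun hBB => (hBB ha.1).2 ?_⟩
      exact ⟨⟨ha.1, haB₁⟩, a, ha, ⟨ha.1, haB₁⟩, .refl⟩

/-- The separator theorem of Alon, Seymour and Thomas, for the counting measure: in a graph
without a `K_h` minor, `O(√n)` vertices leave only connected parts with at most half of the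
vertices. -/
theorem exists_separator {h t : ℕ} (ht : 0 < t) (hn : h * Fintype.card V ≤ t * t)
    (hminor : ¬ IsMinor (⊤ : SimpleGraph (Fin h)) G) :
    ∃ X : Set V, X.ncard ≤ h * t ∧ ∀ B : Set V, ConnOn G B → Disjoint B X →
      (∀ v ∈ B, ∀ u, G.Adj v u → u ∈ B ∨ u ∈ X) → 2 * B.ncard ≤ Fintype.card V := by
  by_contra! hsep
  -- Infinite descent: without a separator, every covey would give rise to one of smaller potential.
  have hno : ∀ (m : ℕ) (I : Finset (Fin h)) (C X : Fin h → Set V) (B : Set V),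
      B.ncard * (h + 1) + I.card = m → ¬ Covey G h t I C X B := by
    intro m
    induction m using Nat.strong_induction_on with
    | _ m ih =>
      intro I C X B hm hC
      obtain ⟨I', C', X', B', hC', hlt⟩ := hC.exists_smaller ht hn hminor hsep
      exact ih _ (hm ▸ hlt) I' C' X' B' rfl hC'
  obtain ⟨B, h1, h2, h3, h4⟩ := hsep ∅ (by simp)
  refine hno _ ∅ (fun _ => ∅) (fun _ => ∅) B rfl
    ⟨by simp, by simp, by simp, by simp, by simp, h1, h4, by simp, fun v hv u huv => ?_⟩
  simpa using h3 v hv u huv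

end Separator

/-! ### Divisions of graphs without a complete minor -/

section Division

theorem ReachIn.map {V W : Type*} {G : SimpleGraph V} {G' : SimpleGraph W} (f : G →g G')
    {S : Set V} {a b : V} (h : ReachIn G S a b) : ReachIn G' (f '' S) (f a) (f b) :=
  Relation.ReflTransGen.lift f (fun _ _ hab => ⟨f.map_adj hab.1, Set.mem_image_of_mem _ hab.2.1,
    Set.mem_image_of_mem _ hab.2.2⟩) _ _ h

theorem ConnOn.map {V W : Type*} {G : SimpleGraph V} {G' : SimpleGraph W} (f : G →g G')
    {S : Set V} (h : ConnOn G S) : ConnOn G' (f '' S) := by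
  refine ⟨h.1.image f, ?_⟩
  rintro _ ⟨u, hu, rfl⟩ _ ⟨v, hv, rfl⟩
  exact (h.2 u hu v hv).map f

theorem IsMinor.map {U V W : Type*} {H : SimpleGraph U} {G : SimpleGraph V} {G' : SimpleGraph W}
    (h : IsMinor H G) (f : G →g G') (hf : Function.Injective f) : IsMinor H G' := by
  obtain ⟨B, h1, h2, h3⟩ := h
  refine ⟨fun x => f '' B x, fun x => connOn_iff.1 ((connOn_iff.2 (h1 x)).map f),
    fun x y hxy => (Set.disjoint_image_iff hf).2 (h2 x y hxy), fun x y hxy => ?_⟩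
  obtain ⟨u, hu, v, hv, huv⟩ := h3 x y hxy
  exact ⟨f u, Set.mem_image_of_mem _ hu, f v, Set.mem_image_of_mem _ hv, f.map_adj huv⟩

theorem IsMinor.mono_left {U V : Type*} {H H' : SimpleGraph U} {G : SimpleGraph V} (hH : H ≤ H')
    (h : IsMinor H' G) : IsMinor H G := by
  obtain ⟨B, h1, h2, h3⟩ := h
  exact ⟨B, h1, h2, fun x y hxy => h3 x y (hH hxy)⟩

open Classical in
/-- A balanced separation: two overlapping halves that contain all edges. -/
theorem exists_separation {V : Type*} [Fintype V] {G : SimpleGraph V} {h t : ℕ} (ht : 0 < t)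
    (hn : h * Fintype.card V ≤ t * t) (hminor : ¬ IsMinor (⊤ : SimpleGraph (Fin h)) G) :
    ∃ A B : Finset V, (∀ v, v ∈ A ∨ v ∈ B) ∧
      (∀ u v, G.Adj u v → (u ∈ A ∧ v ∈ A) ∨ (u ∈ B ∧ v ∈ B)) ∧
      A.card + B.card ≤ Fintype.card V + h * t ∧
      3 * A.card ≤ 2 * Fintype.card V + 3 * (h * t) ∧
      3 * B.card ≤ 2 * Fintype.card V + 3 * (h * t) := by
  obtain ⟨X', hXcard, hX⟩ := exists_separator ht hn hminor
  obtain ⟨X, rfl⟩ : ∃ X : Finset V, X' = X := ⟨X'.toFinset, by simp⟩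
  rw [Set.ncard_coe_finset] at hXcard
  -- unions of components of the complement of `X` with at most two thirds of the vertices
  let F : Finset (Finset V) := Finset.univ.filter fun A => Disjoint A X ∧
    (∀ v ∈ A, ∀ u, G.Adj v u → u ∈ A ∨ u ∈ X) ∧ 3 * A.card ≤ 2 * Fintype.card V
  have hF : ∀ A, A ∈ F ↔ Disjoint A X ∧
    (∀ v ∈ A, ∀ u, G.Adj v u → u ∈ A ∨ u ∈ X) ∧ 3 * A.card ≤ 2 * Fintype.card V := by
    intro A; simp [F]
  obtain ⟨A, hAF, hmax⟩ := F.exists_max_image Finset.card ⟨∅, by simp [hF]⟩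
  obtain ⟨hAX, hAcl, hAcard⟩ := (hF A).1 hAF
  have hcardAX : (A ∪ X).card = A.card + X.card := Finset.card_union_of_disjoint hAX
  set B : Finset V := Finset.univ \ (A ∪ X) with hB
  have hmemB : ∀ v, v ∈ B ↔ v ∉ A ∧ v ∉ X := by intro v; simp [hB]
  have hcardB : B.card + (A.card + X.card) = Fintype.card V := by
    have := Finset.card_sdiff_add_card_eq_card (Finset.subset_univ (A ∪ X))
    rwa [hcardAX, Finset.card_univ] at this
  have hBcl : ∀ v ∈ B, ∀ u, G.Adj v u → u ∈ B ∨ u ∈ X := by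
    intro v hv u huv
    by_cases huX : u ∈ X
    · exact Or.inr huX
    refine Or.inl ((hmemB u).2 ⟨fun huA => ?_, huX⟩)
    have hv' := (hmemB v).1 hv
    exact (hAcl u huA v huv.symm).elim hv'.1 hv'.2
  -- If `B` were too large, take a component `D` of `B`, which has at most half of the vertices. By
  -- maximality `|D| ≤ |A|` and `A ∪ D` exceeds two thirds. So `A` exceeds one third, which leaves
  -- less than two thirds for `B`.
  have hBcard : 3 * B.card ≤ 2 * Fintype.card V := by
    by_contra! hlt
    obtain ⟨v, hv⟩ := Finset.card_pos.1 (by omega : 0 < B.card)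
    let D : Finset V := Finset.univ.filter fun u => ReachIn G (B : Set V) v u
    have hDB : ∀ u ∈ D, u ∈ B := by
      intro u hu
      exact ReachIn.mem (Finset.mem_filter.1 hu).2 (by exact_mod_cast hv)
    have hDcl : ∀ u ∈ D, ∀ w, G.Adj u w → w ∈ D ∨ w ∈ X := by
      intro u hu w huw
      refine (hBcl u (hDB u hu) w huw).imp_left fun hw => ?_
      refine Finset.mem_filter.2 ⟨Finset.mem_univ _, (Finset.mem_filter.1 hu).2.tail ?_⟩
      exact ⟨huw, by exact_mod_cast hDB u hu, by exact_mod_cast hw⟩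
    have hvD : v ∈ D := Finset.mem_filter.2 ⟨Finset.mem_univ _, .refl⟩
    have hDX : Disjoint D X :=
      Finset.disjoint_left.2 fun u hu => ((hmemB u).1 (hDB u hu)).2
    have hDA : Disjoint A D :=
      Finset.disjoint_left.2 fun u huA hu => ((hmemB u).1 (hDB u hu)).1 huA
    have hDconn : ConnOn G (D : Set V) := by
      have hr : ∀ u, ReachIn G (B : Set V) v u → ReachIn G (D : Set V) v u := by
        intro u hu
        induction hu with
        | refl => exact .refl
        | tail hab hbc ih =>
          exact ih.tail ⟨hbc.1, by simpa [D] using hab, by simpa [D] using hab.tail hbc⟩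
      refine (connOn_singleton (G := G) v).of_core (by simpa using hvD) fun u hu => ⟨v, rfl, ?_⟩
      exact (hr u (by simpa [D] using hu)).symm
    have hDcard := hX D hDconn (by exact_mod_cast hDX)
      (fun u hu w huw => by simpa using hDcl u (by simpa using hu) w huw)
    rw [Set.ncard_coe_finset] at hDcard
    have hDF := hmax D ((hF D).2 ⟨hDX, hDcl, by omega⟩)
    have hunion : (A ∪ D).card = A.card + D.card := Finset.card_union_of_disjoint hDA
    have hpos : 0 < D.card := Finset.card_pos.2 ⟨v, hvD⟩
    by_cases hsmall : 3 * (A ∪ D).card ≤ 2 * Fintype.card V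
    · have := hmax (A ∪ D) ((hF _).2 ⟨Finset.disjoint_union_left.2 ⟨hAX, hDX⟩, ?_, hsmall⟩)
      · omega
      · intro u hu w huw
        rcases Finset.mem_union.1 hu with hu | hu
        · exact (hAcl u hu w huw).imp_left fun hw => Finset.mem_union_left _ hw
        · exact (hDcl u hu w huw).imp_left fun hw => Finset.mem_union_right _ hw
    · omega
  have hcardBX : (B ∪ X).card ≤ B.card + X.card := Finset.card_union_le _ _
  refine ⟨A ∪ X, B ∪ X, fun v => ?_, fun u v huv => ?_, by omega, by omega, by omega⟩
  · by_cases hA : v ∈ A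
    · simp [hA]
    by_cases hX : v ∈ X
    · simp [hX]
    exact Or.inr (Finset.mem_union_left _ ((hmemB v).2 ⟨hA, hX⟩))
  · have hsplit : ∀ u v, G.Adj u v → u ∉ X →
        (u ∈ A ∪ X ∧ v ∈ A ∪ X) ∨ (u ∈ B ∪ X ∧ v ∈ B ∪ X) := by
      intro u v huv hu
      simp only [Finset.mem_union]
      by_cases hA : u ∈ A
      · exact Or.inl ⟨Or.inl hA, hAcl u hA v huv⟩
      · have hB : u ∈ B := (hmemB u).2 ⟨hA, hu⟩
        exact Or.inr ⟨Or.inl hB, hBcl u hB v huv⟩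
    by_cases hu : u ∈ X
    · by_cases hv : v ∈ X
      · exact Or.inl ⟨Finset.mem_union_right _ hu, Finset.mem_union_right _ hv⟩
      · exact (hsplit v u huv.symm hv).imp And.symm And.symm
    · exact hsplit u v huv hu

/-- The sets in the list `Ps` are subsets of `W` of size at most `q ^ 2` that contain all vertices
and all edges of `G[W]`. -/
structure IsDivision {V : Type*} (G : SimpleGraph V) (W : Finset V) (q : ℝ)
    (Ps : List (Finset V)) : Prop where
  sub : ∀ P ∈ Ps, P ⊆ W
  card_le : ∀ P ∈ Ps, (P.card : ℝ) ≤ q ^ 2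
  cover : ∀ v ∈ W, ∃ P ∈ Ps, v ∈ P
  edge : ∀ u ∈ W, ∀ v ∈ W, G.Adj u v → ∃ P ∈ Ps, u ∈ P ∧ v ∈ P

theorem IsDivision.singleton {V : Type*} {G : SimpleGraph V} {W : Finset V} {q : ℝ}
    (h : (W.card : ℝ) ≤ q ^ 2) : IsDivision G W q [W] :=
  ⟨by simp, by simpa using h, by simp, by simp +contextual⟩

theorem exists_separation_within {V : Type*} {G : SimpleGraph V} {W : Finset V} {h t : ℕ}
    (ht : 0 < t) (hn : h * W.card ≤ t * t)
    (hminor : ¬ IsMinor (⊤ : SimpleGraph (Fin h)) (G.induce (W : Set V))) :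
    ∃ A B : Finset V, A ⊆ W ∧ B ⊆ W ∧ (∀ v ∈ W, v ∈ A ∨ v ∈ B) ∧
      (∀ u ∈ W, ∀ v ∈ W, G.Adj u v → (u ∈ A ∧ v ∈ A) ∨ (u ∈ B ∧ v ∈ B)) ∧
      A.card + B.card ≤ W.card + h * t ∧
      3 * A.card ≤ 2 * W.card + 3 * (h * t) ∧
      3 * B.card ≤ 2 * W.card + 3 * (h * t) := by
  have hcard : Fintype.card (W : Set V) = W.card := by simp
  obtain ⟨A, B, h1, h2, h3, h4, h5⟩ :=
    exists_separation (G := G.induce (W : Set V)) ht (by rw [hcard]; exact hn) hminor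
  rw [hcard] at h3 h4 h5
  have hmem : ∀ (S : Finset (W : Set V)) (v : V) (hv : v ∈ (W : Set V)), (⟨v, hv⟩ : (W : Set V)) ∈ S →
      v ∈ S.map (Function.Embedding.subtype _) := by
    intro S v hv hS
    exact Finset.mem_map.2 ⟨⟨v, hv⟩, hS, rfl⟩
  refine ⟨A.map (Function.Embedding.subtype _), B.map (Function.Embedding.subtype _), ?_, ?_, ?_, ?_,
    by simpa using h3, by simpa using h4, by simpa using h5⟩
  · intro v hv
    obtain ⟨x, -, rfl⟩ := Finset.mem_map.1 hv
    exact x.2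
  · intro v hv
    obtain ⟨x, -, rfl⟩ := Finset.mem_map.1 hv
    exact x.2
  · intro v hv
    exact (h1 ⟨v, hv⟩).imp (hmem A v hv) (hmem B v hv)
  · intro u hu v hv huv
    exact (h2 ⟨u, hu⟩ ⟨v, hv⟩ huv).imp (And.imp (hmem A u hu) (hmem A v hv))
      (And.imp (hmem B u hu) (hmem B v hv))

theorem not_isMinor_induce_of_subset {U V : Type*} {H : SimpleGraph U} {G : SimpleGraph V}
    {A W : Set V} (hAW : A ⊆ W) (h : ¬ IsMinor H (G.induce W)) : ¬ IsMinor H (G.induce A) :=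
  fun hA => h (hA.map (SimpleGraph.induceHomOfLE G hAW).toHom
    (SimpleGraph.induceHomOfLE G hAW).injective)

/-- The square of the right-hand side is `a + b + 2 √a √b ≥ m + m / 2`, while `(6 / 5) ^ 2 < 3 / 2`.
-/
theorem sqrt_add_sqrt_ge {a b m : ℝ} (hm : 0 ≤ m) (ha : m ≤ 4 * a) (hb : m ≤ 4 * b)
    (hab : m ≤ a + b) : 6 / 5 * √m ≤ √a + √b := by
  have hx := Real.sqrt_nonneg m
  have h1 : √m / 2 ≤ √a := Real.le_sqrt_of_sq_le (by rw [div_pow, Real.sq_sqrt hm]; linarith)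
  have h2 : √m / 2 ≤ √b := Real.le_sqrt_of_sq_le (by rw [div_pow, Real.sq_sqrt hm]; linarith)
  have ha2 := Real.sq_sqrt (by linarith : 0 ≤ a)
  have hb2 := Real.sq_sqrt (by linarith : 0 ≤ b)
  have hm2 := Real.sq_sqrt hm
  have h3 : √m / 2 * (√m / 2) ≤ √a * √b := by gcongr
  refine le_of_sq_le_sq ?_ (by positivity)
  nlinarith

/-- The bound needed is `m + 20 c m / q`. The negative term `- 10 c √m` strengthens the induction:
square roots gain a constant factor when a set is split in a balanced way, and this gain pays for
the separator. The hypothesis `q ^ 2 ≤ 4 m` keeps the sets large enough for the negative term to be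
affordable when the recursion stops. -/
theorem exists_division_of_large {V : Type*} {G : SimpleGraph V} {h : ℕ} (hh : 0 < h) {q c : ℝ}
    (hc : c = 2 * (h : ℝ) ^ 2) (hq : 20 * c ≤ q) (m : ℕ) :
    ∀ W : Finset V, W.card = m → ¬ IsMinor (⊤ : SimpleGraph (Fin h)) (G.induce (W : Set V)) →
      q ^ 2 ≤ 4 * (m : ℝ) → ∃ Ps, IsDivision G W q Ps ∧
        ((Ps.map Finset.card).sum : ℝ) ≤ m + 20 * c * m / q - 10 * c * √m := by
  have hh' : (1 : ℝ) ≤ h := by exact_mod_cast hh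
  have hc1 : 2 ≤ c := by rw [hc]; nlinarith
  have hq0 : 0 < q := by linarith
  induction m using Nat.strong_induction_on with
  | _ m ih =>
    intro W hW hminor hqm
    have hm0 : (0 : ℝ) < m := by nlinarith
    have hx0 := Real.sqrt_nonneg (m : ℝ)
    have hx2 := Real.sq_sqrt hm0.le
    by_cases hmq : (m : ℝ) ≤ q ^ 2
    · refine ⟨[W], IsDivision.singleton (by rw [hW]; exact hmq), ?_⟩
      have h1 : q / 2 ≤ √(m : ℝ) := Real.le_sqrt_of_sq_le (by rw [div_pow]; linarith)
      have h2 : 10 * c * √(m : ℝ) ≤ 20 * c * m / q := by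
        rw [le_div_iff₀ hq0]
        have : √(m : ℝ) * q ≤ 2 * m := by nlinarith
        nlinarith
      simp only [List.map_cons, List.map_nil, List.sum_cons, List.sum_nil, hW, add_zero]
      linarith
    push Not at hmq
    have hqx : q ≤ √(m : ℝ) := Real.le_sqrt_of_sq_le hmq.le
    set x := √(m : ℝ) with hx
    -- Take `t = ⌈√(h m)⌉`. Both `√(h m)` and the rounding error `1` are at most `h √m`, so the
    -- separator has at most `2 h ^ 2 √m = c √m` vertices.
    obtain ⟨t, ht0, ht1, ht2⟩ : ∃ t : ℕ, 0 < t ∧ h * m ≤ t * t ∧ ((h * t : ℕ) : ℝ) ≤ c * x := by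
      have hpos : (0 : ℝ) < √((h * m : ℕ) : ℝ) := Real.sqrt_pos.2 (by push_cast; positivity)
      refine ⟨⌈√((h * m : ℕ) : ℝ)⌉₊, Nat.ceil_pos.2 hpos, ?_, ?_⟩
      · have h1 := Nat.le_ceil (√((h * m : ℕ) : ℝ))
        have h2 := Real.mul_self_sqrt (Nat.cast_nonneg (α := ℝ) (h * m))
        have h3 := mul_self_le_mul_self hpos.le h1
        rw [h2] at h3
        exact_mod_cast h3
      · have h1 := (Nat.ceil_lt_add_one hpos.le).le
        have h2 : √((h * m : ℕ) : ℝ) ≤ h * x := by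
          apply Real.sqrt_le_iff.2
          refine ⟨by positivity, ?_⟩
          rw [mul_pow, hx2, Nat.cast_mul]
          have : (h : ℝ) ≤ h ^ 2 := by nlinarith
          exact mul_le_mul_of_nonneg_right this hm0.le
        have h3 : (1 : ℝ) ≤ h * x := by nlinarith
        push_cast
        rw [hc]
        push_cast at h1 h2
        have h4 := mul_le_mul_of_nonneg_left h1 (by linarith : (0 : ℝ) ≤ h)
        have h5 := mul_le_mul_of_nonneg_left h2 (by linarith : (0 : ℝ) ≤ h)
        have h6 := mul_le_mul_of_nonneg_left h3 (by linarith : (0 : ℝ) ≤ h)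
        nlinarith
    obtain ⟨A, B, hAW, hBW, hcov, hedge, hsum, hA, hB⟩ :=
      exists_separation_within ht0 (by rw [hW]; exact ht1) hminor
    rw [hW] at hsum hA hB
    have hAr : 3 * (A.card : ℝ) ≤ 2 * m + 3 * ((h * t : ℕ) : ℝ) := by exact_mod_cast hA
    have hBr : 3 * (B.card : ℝ) ≤ 2 * m + 3 * ((h * t : ℕ) : ℝ) := by exact_mod_cast hB
    have hsumr : (A.card : ℝ) + B.card ≤ m + ((h * t : ℕ) : ℝ) := by exact_mod_cast hsum
    have hge : (m : ℝ) ≤ A.card + B.card := by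
      classical
      have h1 : W ⊆ A ∪ B := fun v hv => Finset.mem_union.2 (hcov v hv)
      have h2 := (Finset.card_le_card h1).trans (Finset.card_union_le _ _)
      rw [hW] at h2
      exact_mod_cast h2
    -- From `√m ≥ q ≥ 20 c` the overlap is at most `m / 20`. Both halves are then smaller than `m`
    -- but at least `m / 4 ≥ q ^ 2 / 4`, as the induction hypothesis requires.
    have hcx : 20 * (c * x) ≤ m := by nlinarith
    have ha4 : (m : ℝ) ≤ 4 * A.card := by linarith
    have hb4 : (m : ℝ) ≤ 4 * B.card := by linarith
    have halt : A.card < m := by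
      have : (A.card : ℝ) < m := by linarith
      exact_mod_cast this
    have hblt : B.card < m := by
      have : (B.card : ℝ) < m := by linarith
      exact_mod_cast this
    obtain ⟨Ps, hPs, hPsum⟩ := ih _ halt A rfl
      (not_isMinor_induce_of_subset (by exact_mod_cast hAW) hminor) (by linarith)
    obtain ⟨Qs, hQs, hQsum⟩ := ih _ hblt B rfl
      (not_isMinor_induce_of_subset (by exact_mod_cast hBW) hminor) (by linarith)
    refine ⟨Ps ++ Qs, ⟨?_, ?_, ?_, ?_⟩, ?_⟩
    · intro P hP
      rcases List.mem_append.1 hP with hP | hP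
      · exact (hPs.sub P hP).trans hAW
      · exact (hQs.sub P hP).trans hBW
    · intro P hP
      exact (List.mem_append.1 hP).elim (hPs.card_le P) (hQs.card_le P)
    · intro v hv
      rcases hcov v hv with hv | hv
      · obtain ⟨P, hP, h⟩ := hPs.cover v hv
        exact ⟨P, List.mem_append_left _ hP, h⟩
      · obtain ⟨P, hP, h⟩ := hQs.cover v hv
        exact ⟨P, List.mem_append_right _ hP, h⟩
    · intro u hu v hv huv
      rcases hedge u hu v hv huv with h | h
      · obtain ⟨P, hP, h⟩ := hPs.edge u h.1 v h.2 huv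
        exact ⟨P, List.mem_append_left _ hP, h⟩
      · obtain ⟨P, hP, h⟩ := hQs.edge u h.1 v h.2 huv
        exact ⟨P, List.mem_append_right _ hP, h⟩
    · have hs := sqrt_add_sqrt_ge hm0.le ha4 hb4 hge
      rw [← hx] at hs
      have hdiv : 20 * c * (A.card : ℝ) / q + 20 * c * (B.card : ℝ) / q ≤
          20 * c * m / q + c * x := by
        rw [← add_div, div_add' _ _ _ hq0.ne', div_le_div_iff_of_pos_right hq0]
        have h1 : 20 * c * ((A.card : ℝ) + B.card) ≤ 20 * c * (m + c * x) := by
          apply mul_le_mul_of_nonneg_left _ (by linarith)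
          linarith
        have h2 : (20 * c) * (c * x) ≤ q * (c * x) :=
          mul_le_mul_of_nonneg_right hq (by positivity)
        nlinarith
      have hs' : 12 * c * x ≤ 10 * c * (√(A.card : ℝ) + √(B.card : ℝ)) := by
        have := mul_le_mul_of_nonneg_left hs (by linarith : 0 ≤ 10 * c)
        nlinarith
      rw [List.map_append, List.sum_append]
      push_cast
      push_cast at hPsum hQsum
      nlinarith

/-- Graphs without a `K_h` minor have divisions into pieces of size `q ^ 2` with total overlap
`O(m / q)`. -/
theorem exists_division {V : Type*} {G : SimpleGraph V} {h : ℕ} (hh : 0 < h) {q c : ℝ}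
    (hc : c = 2 * (h : ℝ) ^ 2) (hq : 20 * c ≤ q) (W : Finset V)
    (hminor : ¬ IsMinor (⊤ : SimpleGraph (Fin h)) (G.induce (W : Set V))) :
    ∃ Ps, IsDivision G W q Ps ∧
      ((Ps.map Finset.card).sum : ℝ) ≤ W.card + 20 * c * W.card / q := by
  have hc0 : 0 ≤ c := by rw [hc]; positivity
  by_cases hqm : q ^ 2 ≤ 4 * (W.card : ℝ)
  · obtain ⟨Ps, h1, h2⟩ := exists_division_of_large hh hc hq W.card W rfl hminor hqm
    refine ⟨Ps, h1, h2.trans ?_⟩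
    have : 0 ≤ 10 * c * √(W.card : ℝ) := by positivity
    linarith
  · refine ⟨[W], IsDivision.singleton (by nlinarith [Nat.cast_nonneg (α := ℝ) W.card]), ?_⟩
    have : 0 ≤ 20 * c * (W.card : ℝ) / q := by
      have : 0 ≤ q := by linarith
      positivity
    simp only [List.map_cons, List.map_nil, List.sum_cons, List.sum_nil, add_zero]
    linarith

end Division

/-! ### Shortest paths -/

section Distance

variable {V : Type*} {G : SimpleGraph V} {w : Sym2 V → ℝ≥0}

@[simp] theorem walkWeight_nil (u : V) : walkWeight w (SimpleGraph.Walk.nil : G.Walk u u) = 0 := by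
  simp [walkWeight]

@[simp] theorem walkWeight_cons {u v x : V} (h : G.Adj u v) (p : G.Walk v x) :
    walkWeight w (SimpleGraph.Walk.cons h p) = w s(u, v) + walkWeight w p := by
  simp [walkWeight]

theorem walkWeight_append {u v x : V} (p : G.Walk u v) (q : G.Walk v x) :
    walkWeight w (p.append q) = walkWeight w p + walkWeight w q := by
  simp [walkWeight, SimpleGraph.Walk.edges_append]

theorem walkWeight_reverse {u v : V} (p : G.Walk u v) :
    walkWeight w p.reverse = walkWeight w p := by
  simp [walkWeight, SimpleGraph.Walk.edges_reverse, List.sum_reverse]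

theorem walkWeight_bypass_le [DecidableEq V] {u v : V} (p : G.Walk u v) :
    walkWeight w p.bypass ≤ walkWeight w p := by
  have h1 : p.bypass.edges.Subperm p.edges :=
    List.subperm_of_subset (p.bypass_isPath.isTrail.edges_nodup) p.edges_bypass_subset_edges
  obtain ⟨l, hl, hs⟩ := h1
  unfold walkWeight
  rw [← (hl.map w).sum_eq]
  exact (hs.map w).sum_le_sum (by simp)

theorem wdist_le {u v : V} (p : G.Walk u v) : wdist G w u v ≤ walkWeight w p :=
  ciInf_le' _ p

-- Shortcutting a walk to a path does not increase its weight, so the infimum may be taken over the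
-- finitely many paths.
open Classical in
theorem exists_shortest [Fintype V] (hG : G.Connected) (w : Sym2 V → ℝ≥0) (u v : V) :
    ∃ p : G.Walk u v, walkWeight w p = wdist G w u v := by
  have hne : Nonempty (G.Path u v) := by
    obtain ⟨p⟩ := hG.preconnected u v
    exact ⟨p.toPath⟩
  obtain ⟨p, hp⟩ := Finite.exists_min fun p : G.Path u v => walkWeight w (p : G.Walk u v)
  have : Nonempty (G.Walk u v) := ⟨p.1⟩
  refine ⟨p.1, le_antisymm (le_ciInf fun q => ?_) (wdist_le _)⟩
  exact (hp q.toPath).trans (walkWeight_bypass_le q)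

theorem wdist_self (u : V) : wdist G w u u = 0 :=
  le_antisymm ((wdist_le SimpleGraph.Walk.nil).trans (by simp)) (zero_le)

variable [Fintype V]

theorem wdist_triangle (hG : G.Connected) (u v x : V) :
    wdist G w u x ≤ wdist G w u v + wdist G w v x := by
  obtain ⟨p, hp⟩ := exists_shortest hG w u v
  obtain ⟨q, hq⟩ := exists_shortest hG w v x
  rw [← hp, ← hq, ← walkWeight_append]
  exact wdist_le _

theorem wdist_comm (hG : G.Connected) (u v : V) : wdist G w u v = wdist G w v u := by
  have h : ∀ u v, wdist G w u v ≤ wdist G w v u := by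
    intro u v
    obtain ⟨p, hp⟩ := exists_shortest hG w v u
    rw [← hp, ← walkWeight_reverse]
    exact wdist_le _
  exact le_antisymm (h u v) (h v u)

/-- A shortest walk, all of whose vertices are metrically between the end points. -/
theorem exists_geodesic (hG : G.Connected) (w : Sym2 V → ℝ≥0) (u v : V) :
    ∃ p : G.Walk u v, ∀ x ∈ p.support, wdist G w u x + wdist G w x v = wdist G w u v := by
  classical
  obtain ⟨p, hp⟩ := exists_shortest hG w u v
  refine ⟨p, fun x hx => le_antisymm ?_ (wdist_triangle hG u x v)⟩
  rw [← hp]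
  conv_rhs => rw [← p.take_spec hx, walkWeight_append]
  exact add_le_add (wdist_le _) (wdist_le _)

theorem wdist_pos (hG : G.Connected) (hw : ∀ e, 0 < w e) {u v : V} (huv : u ≠ v) :
    0 < wdist G w u v := by
  obtain ⟨p, hp⟩ := exists_shortest hG w u v
  rw [← hp]
  cases p with
  | nil => exact absurd rfl huv
  | cons h p =>
    rw [walkWeight_cons]
    exact add_pos_of_pos_of_nonneg (hw _) (zero_le)

omit [Fintype V] in
theorem reachIn_of_walk {S : Set V} {u v : V} (p : G.Walk u v) (hp : ∀ x ∈ p.support, x ∈ S) :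
    ReachIn G S u v := by
  induction p with
  | nil => exact .refl
  | cons h p ih =>
    refine (ih fun x hx => hp x (by simp [hx])).head ⟨h, hp _ (by simp), hp _ (by simp)⟩

/-- Zero weights can be removed without changing the independent sets. -/
theorem exists_positive_weight (hG : G.Connected) (w : Sym2 V → ℝ≥0) (ρ : ℝ) :
    ∃ (w' : Sym2 V → ℝ≥0) (ρ' : ℝ), (∀ e, 0 < w' e) ∧
      ∀ x y, ρ < (wdist G w x y : ℝ) ↔ ρ' < (wdist G w' x y : ℝ) := by
  choose p hp using exists_shortest hG w
  obtain ⟨N, hN⟩ : ∃ N : ℕ, ∀ x y, (p x y).length ≤ N :=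
    ⟨∑ x, ∑ y, (p x y).length, fun x y =>
      (Finset.single_le_sum (f := fun y => (p x y).length) (fun _ _ => Nat.zero_le _)
        (Finset.mem_univ y)).trans
      (Finset.single_le_sum (f := fun x => ∑ y, (p x y).length) (fun _ _ => Nat.zero_le _)
        (Finset.mem_univ x))⟩
  -- Only finitely many strict inequalities have to survive, so one small `δ` serves all pairs.
  have hev : ∀ᶠ δ : ℝ in nhdsWithin 0 (Set.Ioi 0), ∀ x y, ρ < (wdist G w x y : ℝ) →
      ρ + δ * N < (wdist G w x y : ℝ) := by
    refine Filter.eventually_all.2 fun x => Filter.eventually_all.2 fun y => ?_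
    by_cases h : ρ < (wdist G w x y : ℝ)
    · have hc : Filter.Tendsto (fun δ : ℝ => ρ + δ * N) (nhds 0) (nhds (ρ + 0 * N)) :=
        (by fun_prop : Continuous fun δ : ℝ => ρ + δ * N).tendsto 0
      rw [zero_mul, add_zero] at hc
      filter_upwards [nhdsWithin_le_nhds (hc.eventually_lt_const h)] with δ hδ _ using hδ
    · filter_upwards with δ h' using absurd h' h
  obtain ⟨δ, hδ, hδ0⟩ := (hev.and self_mem_nhdsWithin).exists
  have hδ0 : (0 : ℝ) < δ := hδ0
  lift δ to ℝ≥0 using hδ0.le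
  have hww : ∀ {x y : V} (q : G.Walk x y),
      walkWeight (fun e => w e + δ) q = walkWeight w q + δ * q.length := by
    intro x y q
    induction q with
    | nil => simp
    | cons h q ih =>
      rw [walkWeight_cons, walkWeight_cons, ih, SimpleGraph.Walk.length_cons]
      push_cast
      ring
  -- Every edge becomes longer by `δ`. Distances do not decrease, and each grows by at most `δ N`
  -- because some shortest walk has at most `N` edges. The new radius `ρ + δ N` therefore separates
  -- the same pairs.
  refine ⟨fun e => w e + δ, ρ + δ * N,
    fun e => add_pos_of_nonneg_of_pos (zero_le) (by exact_mod_cast hδ0), fun x y => ?_⟩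
  constructor
  · intro h
    refine (hδ x y h).trans_le ?_
    obtain ⟨q, hq⟩ := exists_shortest hG (fun e => w e + δ) x y
    rw [← hq, hww]
    exact_mod_cast (wdist_le q).trans le_self_add
  · intro h
    by_contra! hle
    refine absurd h (not_lt.2 ?_)
    have h1 := wdist_le (w := fun e => w e + δ) (p x y)
    rw [hww, hp] at h1
    have h2 : (wdist G (fun e => w e + δ) x y : ℝ) ≤ wdist G w x y + δ * (p x y).length := by
      exact_mod_cast h1
    have h3 : (δ : ℝ) * (p x y).length ≤ δ * N := by
      have : ((p x y).length : ℝ) ≤ N := by exact_mod_cast hN x y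
      gcongr
    linarith

end Distance

/-! ### The exchange graph -/

section Exchange

variable {V : Type*} [Fintype V] [LinearOrder V] {G : SimpleGraph V} {w : Sym2 V → ℝ≥0}

/-- The Voronoi assignment of a set `U` of centers, with ties broken consistently. -/
theorem exists_voronoi (hG : G.Connected) (hw : ∀ e, 0 < w e) {U : Finset V} (hU : U.Nonempty) :
    ∃ c : V → V, (∀ v, c v ∈ U) ∧ (∀ u ∈ U, c u = u) ∧
      (∀ v, ∀ u ∈ U, wdist G w v (c v) ≤ wdist G w v u) ∧
      (∀ v, ReachIn G {x | c x = c v} v (c v)) := by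
  -- Ties are broken by the linear order on the vertices. This makes all vertices of a geodesic from
  -- `v` to its center choose the same center, which is why cells are connected.
  have hmin : ∀ v, ∃ c ∈ U, ∀ u ∈ U, toLex (wdist G w v c, c) ≤ toLex (wdist G w v u, u) :=
    fun v => U.exists_min_image (fun c => toLex (wdist G w v c, c)) hU
  choose c hcU hc using hmin
  have hle : ∀ v, ∀ u ∈ U, wdist G w v (c v) ≤ wdist G w v u := by
    intro v u hu
    rcases Prod.Lex.toLex_le_toLex.1 (hc v u hu) with h | h
    · exact h.le
    · exact h.1.le
  have htie : ∀ v, ∀ u ∈ U, wdist G w v (c v) = wdist G w v u → c v ≤ u := by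
    intro v u hu he
    rcases Prod.Lex.toLex_le_toLex.1 (hc v u hu) with h | h
    · exact absurd he h.ne
    · exact h.2
  refine ⟨c, hcU, ?_, hle, ?_⟩
  · intro u hu
    -- Positive weights are needed here: two centers at distance zero could not both own themselves.
    by_contra hne
    have h1 := hle u u hu
    rw [wdist_self] at h1
    exact absurd h1 (not_le.2 (wdist_pos hG hw (Ne.symm hne)))
  · intro v
    obtain ⟨p, hp⟩ := exists_geodesic hG w v (c v)
    refine reachIn_of_walk p fun x hx => ?_
    have h1 := hp x hx
    have h2 : wdist G w x (c x) = wdist G w x (c v) := by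
      refine le_antisymm (hle x _ (hcU v)) ?_
      have h3 := (hle v (c x) (hcU x)).trans (wdist_triangle hG v x (c x))
      rw [← h1] at h3
      exact le_of_add_le_add_left h3
    refine le_antisymm (htie x _ (hcU v) h2) (htie v _ (hcU x) (le_antisymm (hle v _ (hcU x)) ?_))
    rw [← h1, ← h2]
    exact wdist_triangle hG v x (c x)

omit [Fintype V] [LinearOrder V] in
theorem exists_crossing {c : V → V} {x y : V} {u v : V} (p : G.Walk u v)
    (hp : ∀ z ∈ p.support, c z = x ∨ c z = y) (hu : c u = x) (hv : c v = y) (hxy : x ≠ y) :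
    ∃ a b, c a = x ∧ c b = y ∧ G.Adj a b := by
  induction p with
  | nil => exact absurd (hu.symm.trans hv) hxy
  | @cons u z v h p ih =>
    rcases hp z (by simp) with hz | hz
    · exact ih (fun z hz => hp z (by simp [hz])) hz hv
    · exact ⟨u, z, hu, hz, h⟩

/-- Two independent sets have an exchange graph: a minor of `G` on their union in which all
conflicting pairs are adjacent. -/
theorem exists_exchange_graph (hG : G.Connected) (hw : ∀ e, 0 < w e) {ρ : ℝ} {L O : Finset V}
    (hL : IsIndep G w ρ L) (hO : IsIndep G w ρ O) (hU : (L ∪ O).Nonempty) :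
    ∃ M : SimpleGraph V,
      (∀ x ∈ L, ∀ y ∈ O, x ≠ y → (wdist G w x y : ℝ) ≤ ρ → M.Adj x y) ∧
      ∀ (W : Type) (H : SimpleGraph W), IsMinor H (M.induce ((L ∪ O : Finset V) : Set V)) →
        IsMinor H G := by
  obtain ⟨c, hcU, hcfix, hcle, hcr⟩ := exists_voronoi hG hw hU
  let M : SimpleGraph V :=
    { Adj := fun a b => a ≠ b ∧ ∃ u v, c u = a ∧ c v = b ∧ G.Adj u v
      symm := ⟨fun a b ⟨h, u, v, hu, hv, huv⟩ => ⟨h.symm, v, u, hv, hu, huv.symm⟩⟩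
      loopless := ⟨fun a h => h.1 rfl⟩ }
  refine ⟨M, ?_, ?_⟩
  · intro x hx y hy hxy hd
    refine ⟨hxy, ?_⟩
    obtain ⟨p, hp⟩ := exists_geodesic hG w x y
    refine exists_crossing p (fun v hv => ?_) (hcfix x (Finset.mem_union_left _ hx))
      (hcfix y (Finset.mem_union_right _ hy)) hxy
    -- A vertex `v` of the geodesic is no farther from its center than from `x` or `y`. A center in
    -- `L` is thus within `d(x, y) ≤ ρ` of `x`, hence equal to `x`; likewise a center in `O` equals
    -- `y`.
    have hv' := hp v hv
    rcases Finset.mem_union.1 (hcU v) with hc | hc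
    · left
      by_contra hne
      have h1 := hL x hx (c v) hc (Ne.symm hne)
      have h2 : wdist G w x (c v) ≤ wdist G w x y := by
        rw [← hv']
        exact (wdist_triangle hG x v (c v)).trans
          (add_le_add le_rfl (hcle v y (Finset.mem_union_right _ hy)))
      have h3 : (wdist G w x (c v) : ℝ) ≤ wdist G w x y := by exact_mod_cast h2
      linarith
    · right
      by_contra hne
      have h1 := hO (c v) hc y hy hne
      have h2 : wdist G w (c v) y ≤ wdist G w x y := by
        rw [← hv', wdist_comm hG x v]
        refine (wdist_triangle hG (c v) v y).trans (add_le_add ?_ le_rfl)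
        rw [wdist_comm hG (c v) v]
        exact hcle v x (Finset.mem_union_left _ hx)
      have h3 : (wdist G w (c v) y : ℝ) ≤ wdist G w x y := by exact_mod_cast h2
      linarith
  · rintro W H ⟨B, h1, h2, h3⟩
    let S : W → Set V := fun i => Subtype.val '' B i
    have hSU : ∀ i, ∀ a ∈ S i, c a = a := by
      rintro i _ ⟨a, -, rfl⟩
      exact hcfix _ a.2
    refine ⟨fun i => {v | c v ∈ S i}, fun i => connOn_iff.1 ?_, ?_, ?_⟩
    · have hS : ConnOn M (S i) :=
        (connOn_iff.2 (h1 i)).map (SimpleGraph.Embedding.induce _).toHom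
      have hcell : ∀ v, c v ∈ S i → ReachIn G {v | c v ∈ S i} v (c v) := by
        intro v hv
        refine (hcr v).mono fun x hx => ?_
        rw [Set.mem_ofPred_eq] at hx ⊢
        rwa [hx]
      obtain ⟨a, ha⟩ := hS.1
      have hmem : ∀ b ∈ S i, b ∈ {v | c v ∈ S i} := fun b hb => by
        rw [Set.mem_ofPred_eq, hSU i b hb]; exact hb
      refine (connOn_singleton (G := G) a).of_core (by simpa using hmem a ha) fun v hv =>
        ⟨a, rfl, (hcell v hv).trans ?_⟩
      -- Each edge of `M` is realised by an edge of `G` between the two cells, and one moves inside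
      -- a cell through its center.
      have hr := hS.2 (c v) hv a ha
      generalize c v = b at hr
      clear hv
      induction hr using Relation.ReflTransGen.head_induction_on with
      | refl => exact .refl
      | @head b d hbd _ ih =>
        obtain ⟨⟨-, u, z, rfl, rfl, huz⟩, hb, hd⟩ := hbd
        exact ((hcell u hb).symm.tail ⟨huz, hb, hd⟩).trans ((hcell z hd).trans ih)
    · intro i j hij
      rw [Set.disjoint_left]
      rintro v ⟨a, ha, hav⟩ ⟨b, hb, hbv⟩
      have : a = b := Subtype.ext (hav.trans hbv.symm)
      exact Set.disjoint_left.1 (h2 i j hij) ha (this ▸ hb)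
    · intro i j hij
      obtain ⟨a, ha, b, hb, -, u, v, hu, hv, huv⟩ := h3 i j hij
      exact ⟨u, ⟨a, ha, hu.symm⟩, v, ⟨b, hb, hv.symm⟩, huv⟩

/-- The number of sets in the list that contain `v`. -/
def multiplicity (Ps : List (Finset V)) (v : V) : ℕ :=
  Ps.countP fun P => v ∈ P

omit [Fintype V] in
theorem sum_card_inter (Ps : List (Finset V)) (S : Finset V) :
    (Ps.map fun P => (S ∩ P).card).sum = ∑ v ∈ S, multiplicity Ps v := by
  induction Ps with
  | nil => simp [multiplicity]
  | cons P Ps ih =>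
    rw [List.map_cons, List.sum_cons, ih]
    simp only [multiplicity, List.countP_cons, Finset.sum_add_distrib]
    rw [add_comm, Finset.card_eq_sum_ones, ← Finset.filter_mem_eq_inter, Finset.sum_filter]
    simp

-- Multiplicity counts positions in the list, so a piece that occurs twice gives its vertices
-- multiplicity at least two.
omit [Fintype V] in
theorem eq_of_multiplicity_eq_one {Ps : List (Finset V)} {v : V} (h : multiplicity Ps v = 1)
    {P Q : Finset V} (hP : P ∈ Ps) (hQ : Q ∈ Ps) (hvP : v ∈ P) (hvQ : v ∈ Q) : P = Q := by
  rw [multiplicity, List.countP_eq_length_filter, List.length_eq_one_iff] at h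
  obtain ⟨R, hR⟩ := h
  have hP' : P ∈ Ps.filter fun P => decide (v ∈ P) := List.mem_filter.2 ⟨hP, by simpa using hvP⟩
  have hQ' : Q ∈ Ps.filter fun P => decide (v ∈ P) := List.mem_filter.2 ⟨hQ, by simpa using hvQ⟩
  rw [hR, List.mem_singleton] at hP' hQ'
  rw [hP', hQ']

omit [Fintype V] in
/-- A local optimum loses at most twice the overlap of a division of an exchange graph. -/
theorem card_le_of_division {ρ : ℝ} {s : ℕ} {L O : Finset V} (hL : IsIndep G w ρ L)
    (hopt : ∀ S', ¬ Improves G w ρ s L S') (hO : IsIndep G w ρ O) {M : SimpleGraph V}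
    (hsymm : ∀ x y, wdist G w x y = wdist G w y x)
    (hM : ∀ x ∈ L, ∀ y ∈ O, x ≠ y → (wdist G w x y : ℝ) ≤ ρ → M.Adj x y) {q : ℝ}
    {Ps : List (Finset V)} (hPs : IsDivision M (L ∪ O) q Ps) (hs : ∀ P ∈ Ps, P.card ≤ s) :
    O.card + 2 * (L ∪ O).card ≤ L.card + 2 * (Ps.map Finset.card).sum := by
  set U := L ∪ O with hU
  have hLU : L ⊆ U := Finset.subset_union_left
  have hOU : O ⊆ U := Finset.subset_union_right
  have hm1 : ∀ v ∈ U, 1 ≤ multiplicity Ps v := by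
    intro v hv
    obtain ⟨P, hP, hvP⟩ := hPs.cover v hv
    exact List.countP_pos_iff.2 ⟨P, hP, by simpa using hvP⟩
  set S := O.filter fun v => multiplicity Ps v = 1 with hS
  have hSO : S ⊆ O := Finset.filter_subset _ _
  have hpiece : ∀ P ∈ Ps, (S ∩ P).card ≤ (L ∩ P).card := by
    intro P hP
    by_contra! hlt
    refine hopt ((L \ P) ∪ (S ∩ P)) ⟨?_, ?_, ?_⟩
    · have hcross : ∀ x ∈ L \ P, ∀ y ∈ S ∩ P, x ≠ y → ρ < (wdist G w x y : ℝ) := by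
        intro x hx y hy hxy
        by_contra! hle
        rw [Finset.mem_sdiff] at hx
        rw [Finset.mem_inter] at hy
        obtain ⟨Q, hQ, hxQ, hyQ⟩ := hPs.edge x (Finset.mem_union_left _ hx.1) y
          (Finset.mem_union_right _ (hSO hy.1)) (hM x hx.1 y (hSO hy.1) hxy hle)
        have := eq_of_multiplicity_eq_one (Finset.mem_filter.1 hy.1).2 hP hQ hy.2 hyQ
        exact hx.2 (this ▸ hxQ)
      intro x hx y hy hxy
      rcases Finset.mem_union.1 hx with hx | hx <;> rcases Finset.mem_union.1 hy with hy | hy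
      · exact hL x (Finset.mem_sdiff.1 hx).1 y (Finset.mem_sdiff.1 hy).1 hxy
      · exact hcross x hx y hy hxy
      · rw [hsymm]
        exact hcross y hy x hx hxy.symm
      · exact hO x (hSO (Finset.mem_inter.1 hx).1) y (hSO (Finset.mem_inter.1 hy).1) hxy
    · rw [Finset.card_union_of_disjoint]
      · have := Finset.card_sdiff_add_card_inter L P
        omega
      · exact Finset.disjoint_left.2 fun v h1 h2 =>
          (Finset.mem_sdiff.1 h1).2 (Finset.mem_inter.1 h2).2
    · rw [← Finset.card_union_of_disjoint]
      · refine (Finset.card_le_card fun v hv => ?_).trans (hs P hP)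
        simp only [Finset.mem_union, Finset.mem_sdiff, Finset.mem_inter] at hv
        tauto
      · exact Finset.disjoint_left.2 fun v h1 h2 =>
          (Finset.mem_sdiff.1 h2).2 (Finset.mem_sdiff.1 h1).1
  have hsum : (Ps.map fun P => (S ∩ P).card).sum ≤ (Ps.map fun P => (L ∩ P).card).sum :=
    List.sum_le_sum hpiece
  rw [sum_card_inter, sum_card_inter] at hsum
  have hScard : ∑ v ∈ S, multiplicity Ps v = S.card := by
    rw [Finset.card_eq_sum_ones]
    exact Finset.sum_congr rfl fun v hv => (Finset.mem_filter.1 hv).2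
  have htotal : (Ps.map Finset.card).sum = ∑ v ∈ U, multiplicity Ps v := by
    rw [← sum_card_inter]
    congr 1
    exact List.map_congr_left fun P hP => by rw [Finset.inter_eq_right.2 (hPs.sub P hP)]
  have hLsum : (∑ v ∈ L, multiplicity Ps v) + U.card ≤ (∑ v ∈ U, multiplicity Ps v) + L.card := by
    have h1 := Finset.sum_sdiff (f := multiplicity Ps) hLU
    have h2 := Finset.card_sdiff_add_card_eq_card hLU
    have h3 : (U \ L).card ≤ ∑ v ∈ U \ L, multiplicity Ps v := by
      rw [Finset.card_eq_sum_ones]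
      exact Finset.sum_le_sum fun v hv => hm1 v (Finset.mem_sdiff.1 hv).1
    omega
  have hOsum : O.card + U.card ≤ (∑ v ∈ U, multiplicity Ps v) + S.card := by
    have h1 := Finset.sum_sdiff (f := multiplicity Ps) hOU
    have h2 := Finset.card_sdiff_add_card_eq_card hOU
    have h3 : (U \ O).card ≤ ∑ v ∈ U \ O, multiplicity Ps v := by
      rw [Finset.card_eq_sum_ones]
      exact Finset.sum_le_sum fun v hv => hm1 v (Finset.mem_sdiff.1 hv).1
    have h4 := Finset.sum_sdiff (f := multiplicity Ps) hSO
    have h5 := Finset.card_sdiff_add_card_eq_card hSO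
    have h6 : (O \ S).card * 2 ≤ ∑ v ∈ O \ S, multiplicity Ps v := by
      rw [← smul_eq_mul]
      refine Finset.card_nsmul_le_sum _ _ _ fun v hv => ?_
      rw [Finset.mem_sdiff] at hv
      have h7 := hm1 v (Finset.mem_union_right _ hv.1)
      have h8 : multiplicity Ps v ≠ 1 := fun h => hv.2 (Finset.mem_filter.2 ⟨hv.1, h⟩)
      omega
    omega
  -- Let `Δ` be the total size of the pieces minus `|U|`. Then `|O| ≤ |S| + Δ`, because elements of
  -- `O \ S` are counted at least twice, and `|S|` is at most the sum of multiplicities over `L`,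
  -- which is at most `|L| + Δ`.
  omega

end Exchange

/-! ### Approximation guarantee for local optima -/

section LocalOptima

variable {V : Type*} [Fintype V] [LinearOrder V] {G : SimpleGraph V} {w : Sym2 V → ℝ≥0}

omit [Fintype V] in
theorem IsLocalSearchOutput.isIndep {ρ : ℝ} {s : ℕ} {S : Finset V}
    (h : IsLocalSearchOutput G w ρ s S) : IsIndep G w ρ S := by
  cases h.1 with
  | refl => intro x hx; simp at hx
  | tail _ h => exact h.1

/-- The swap constant for graphs without a minor on `h` vertices. -/
def swapConst (h : ℕ) : ℕ := (160 * h ^ 2) ^ 2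

/-- In a graph without a minor on `h` vertices, local optima are `(1 - ε)`-approximations. -/
theorem card_le_of_locallyOptimal {h : ℕ} {H : SimpleGraph (Fin h)} (hG : G.Connected)
    (hH : MinorFree H G) {ρ ε : ℝ} (hε : 0 < ε) (hε2 : ε < 1 / 2) {L O : Finset V}
    (hL : IsIndep G w ρ L)
    (hopt : ∀ S', ¬ Improves G w ρ ⌈(swapConst h : ℝ) / ε ^ 2⌉₊ L S')
    (hO : IsIndep G w ρ O) : (1 - ε) * (O.card : ℝ) ≤ L.card := by
  have hOL : (O.card : ℝ) ≤ L.card → (1 - ε) * (O.card : ℝ) ≤ L.card := by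
    intro hle
    have := mul_nonneg hε.le (Nat.cast_nonneg (α := ℝ) O.card)
    linarith
  rcases Finset.eq_empty_or_nonempty (L ∪ O) with hU | hU
  · have h1 := Finset.union_eq_empty.1 hU
    simp [h1.1, h1.2]
  -- For `h = 0` the graph `H` is empty and a minor of every graph, so nothing is left to prove.
  have hh : 0 < h := by
    rcases Nat.eq_zero_or_pos h with rfl | hh
    · exact absurd ⟨fun _ => ∅, fun x => x.elim0, fun x => x.elim0, fun x => x.elim0⟩ hH
    · exact hh
  obtain ⟨w', ρ', hw', hiff⟩ := exists_positive_weight hG w ρ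
  have hind : ∀ S : Finset V, IsIndep G w ρ S ↔ IsIndep G w' ρ' S := by
    intro S
    simp only [IsIndep, hiff]
  obtain ⟨M, hM, hminor⟩ := exists_exchange_graph hG hw' ((hind L).1 hL) ((hind O).1 hO) hU
  have hh1 : (1 : ℝ) ≤ h := by exact_mod_cast hh
  set c : ℝ := 2 * (h : ℝ) ^ 2 with hc
  have hc0 : 0 < c := by positivity
  -- The choice `q = 80 c / ε` makes the overlap at most `ε / 4` times `|L ∪ O|`, and `q ^ 2` is the
  -- real number whose ceiling is the swap size.
  have hq : 20 * c ≤ 80 * c / ε := by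
    rw [le_div_iff₀ hε]
    nlinarith
  obtain ⟨Ps, hPs, hsum⟩ := exists_division hh hc hq (L ∪ O) fun hm =>
    hH ((hminor _ _ hm).mono_left le_top)
  have hs : ∀ P ∈ Ps, P.card ≤ ⌈(swapConst h : ℝ) / ε ^ 2⌉₊ := by
    intro P hP
    have h1 := hPs.card_le P hP
    have h2 : (80 * c / ε) ^ 2 = (swapConst h : ℝ) / ε ^ 2 := by
      rw [div_pow, hc, swapConst]
      push_cast
      ring
    rw [h2] at h1
    exact_mod_cast h1.trans (Nat.le_ceil _)
  have hkey := card_le_of_division ((hind L).1 hL)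
    (fun S' h => hopt S' ⟨(hind S').2 h.1, h.2⟩) ((hind O).1 hO) (fun x y => wdist_comm hG x y) hM hPs hs
  have hkey' : (O.card : ℝ) + 2 * ((L ∪ O).card : ℝ) ≤ L.card + 2 * ((Ps.map Finset.card).sum : ℝ) := by
    exact_mod_cast hkey
  have hratio : 20 * c * ((L ∪ O).card : ℝ) / (80 * c / ε) = ε / 4 * ((L ∪ O).card : ℝ) := by
    field_simp
    ring
  rw [hratio] at hsum
  have hUcard : ((L ∪ O).card : ℝ) ≤ L.card + O.card := by exact_mod_cast Finset.card_union_le L O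
  by_cases hle : (O.card : ℝ) ≤ L.card
  · exact hOL hle
  push Not at hle
  -- Since `|L ∪ O| ≤ 2 |O|`, twice the overlap is at most `2 · (ε / 4) · 2 |O| = ε |O|`.
  have := mul_le_mul_of_nonneg_left (hUcard.trans (by linarith : _ ≤ 2 * (O.card : ℝ))) hε.le
  linarith

end LocalOptima

/-! ### Reasoning about programs -/

section Framework

@[simp] theorem Store.writeNat_nats (σ : Store) (a i v b j : ℕ) :
    (σ.writeNat a i v).nats b j = if b = a ∧ j = i then v else σ.nats b j := rfl

@[simp] theorem Store.writeNat_reals (σ : Store) (a i v : ℕ) :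
    (σ.writeNat a i v).reals = σ.reals := rfl

@[simp] theorem Store.writeReal_nats (σ : Store) (a i : ℕ) (v : ℝ) :
    (σ.writeReal a i v).nats = σ.nats := rfl

@[simp] theorem Store.writeReal_reals (σ : Store) (a i : ℕ) (v : ℝ) (b j : ℕ) :
    (σ.writeReal a i v).reals b j = if b = a ∧ j = i then v else σ.reals b j := rfl

/-- The integer arrays a program may write to. -/
def Prog.natWrites : Prog → List ℕ
  | .skip => []
  | .setNat a _ _ => [a]
  | .setReal _ _ _ => []
  | .seq p q => p.natWrites ++ q.natWrites
  | .cond _ p q => p.natWrites ++ q.natWrites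
  | .loop _ p => p.natWrites

/-- The real arrays a program may write to. -/
def Prog.realWrites : Prog → List ℕ
  | .skip => []
  | .setNat _ _ _ => []
  | .setReal a _ _ => [a]
  | .seq p q => p.realWrites ++ q.realWrites
  | .cond _ p q => p.realWrites ++ q.realWrites
  | .loop _ p => p.realWrites

theorem Runs.nats_eq {p : Prog} {σ τ : Store} {t : ℕ} (h : Runs p σ τ t) {a : ℕ}
    (ha : a ∉ p.natWrites) : τ.nats a = σ.nats a := by
  induction h with
  | skip => rfl
  | setNat σ b i e =>
    funext j
    simp only [Prog.natWrites, List.mem_singleton] at ha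
    simp [ha]
  | setReal => rfl
  | seq _ _ ih1 ih2 =>
    simp only [Prog.natWrites, List.mem_append, not_or] at ha
    rw [ih2 ha.2, ih1 ha.1]
  | condTrue _ _ ih =>
    simp only [Prog.natWrites, List.mem_append, not_or] at ha
    exact ih ha.1
  | condFalse _ _ ih =>
    simp only [Prog.natWrites, List.mem_append, not_or] at ha
    exact ih ha.2
  | loopStop => rfl
  | loopStep _ _ _ ih1 ih2 => rw [ih2 ha, ih1 ha]

theorem Runs.reals_eq {p : Prog} {σ τ : Store} {t : ℕ} (h : Runs p σ τ t) {a : ℕ}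
    (ha : a ∉ p.realWrites) : τ.reals a = σ.reals a := by
  induction h with
  | skip => rfl
  | setNat => rfl
  | setReal σ b i e =>
    funext j
    simp only [Prog.realWrites, List.mem_singleton] at ha
    simp [ha]
  | seq _ _ ih1 ih2 =>
    simp only [Prog.realWrites, List.mem_append, not_or] at ha
    rw [ih2 ha.2, ih1 ha.1]
  | condTrue _ _ ih =>
    simp only [Prog.realWrites, List.mem_append, not_or] at ha
    exact ih ha.1
  | condFalse _ _ ih =>
    simp only [Prog.realWrites, List.mem_append, not_or] at ha
    exact ih ha.2
  | loopStop => rfl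
  | loopStep _ _ _ ih1 ih2 => rw [ih2 ha, ih1 ha]

/-- `p` halts from `σ` within `y ^ k` steps, in a memory that satisfies `Q`. -/
def Within (y : ℕ) (p : Prog) (σ : Store) (k : ℕ) (Q : Store → Prop) : Prop :=
  ∃ τ t, Runs p σ τ t ∧ t ≤ y ^ k ∧ Q τ

/-- The memories `σ` and `τ` agree on everything that `p` does not write to. -/
def AgreeOff (p : Prog) (σ τ : Store) : Prop :=
  (∀ a, a ∉ p.natWrites → τ.nats a = σ.nats a) ∧ ∀ a, a ∉ p.realWrites → τ.reals a = σ.reals a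

variable {y : ℕ} {p q : Prog} {σ : Store} {k : ℕ} {Q Q' : Store → Prop}

theorem Within.frame (h : Within y p σ k Q) : Within y p σ k fun τ => Q τ ∧ AgreeOff p σ τ := by
  obtain ⟨τ, t, h1, h2, h3⟩ := h
  exact ⟨τ, t, h1, h2, h3, fun a ha => h1.nats_eq ha, fun a ha => h1.reals_eq ha⟩

theorem Within.imp (h : Within y p σ k Q) (hQ : ∀ τ, Q τ → Q' τ) : Within y p σ k Q' := by
  obtain ⟨τ, t, h1, h2, h3⟩ := h
  exact ⟨τ, t, h1, h2, hQ τ h3⟩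

theorem Within.mono (hy : 2 ≤ y) (h : Within y p σ k Q) {k' : ℕ} (hk : k ≤ k') :
    Within y p σ k' Q := by
  obtain ⟨τ, t, h1, h2, h3⟩ := h
  exact ⟨τ, t, h1, h2.trans (Nat.pow_le_pow_right (by omega) hk), h3⟩

/-- Time bounds are kept as powers of one base `y ≥ 2`. Adding two of them costs one unit of the
exponent, which absorbs all constants. -/
theorem add_le_pow_succ (hy : 2 ≤ y) {a b : ℕ} (ha : a ≤ y ^ k) (hb : b ≤ y ^ k) :
    a + b ≤ y ^ (k + 1) := by
  rw [pow_succ]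
  nlinarith

/-- All single statements and tests of the program cost at most `64 = 2 ^ 6`; this is the source of
the exponent `6`. -/
theorem le_pow_of_le_64 (hy : 2 ≤ y) {c : ℕ} (hc : c ≤ 64) (hk : 6 ≤ k) : c ≤ y ^ k :=
  hc.trans ((by norm_num : 64 ≤ 2 ^ 6).trans
    ((Nat.pow_le_pow_left hy 6).trans (Nat.pow_le_pow_right (by omega) hk)))

theorem Within.skip (hy : 2 ≤ y) (h : Q σ) : Within y .skip σ 6 Q :=
  ⟨σ, 1, .skip σ, le_pow_of_le_64 hy (by norm_num) le_rfl, h⟩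

theorem Within.setNat (hy : 2 ≤ y) {a : ℕ} {i e : NatExpr}
    (h : Q (σ.writeNat a (i.eval σ) (e.eval σ))) (hc : i.cost + e.cost + 1 ≤ 64 := by decide) :
    Within y (.setNat a i e) σ 6 Q :=
  ⟨_, _, .setNat σ a i e, le_pow_of_le_64 hy hc le_rfl, h⟩

theorem Within.setReal (hy : 2 ≤ y) {a : ℕ} {i : NatExpr} {e : RealExpr}
    (h : Q (σ.writeReal a (i.eval σ) (e.eval σ))) (hc : i.cost + e.cost + 1 ≤ 64 := by decide) :
    Within y (.setReal a i e) σ 6 Q :=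
  ⟨_, _, .setReal σ a i e, le_pow_of_le_64 hy hc le_rfl, h⟩

theorem Within.seq (hy : 2 ≤ y) {k₁ k₂ : ℕ} (h1 : Within y p σ k₁ Q')
    (h2 : ∀ τ, Q' τ → Within y q τ k₂ Q) (hk₁ : k₁ + 1 ≤ k := by norm_num)
    (hk₂ : k₂ + 1 ≤ k := by norm_num) : Within y (.seq p q) σ k Q := by
  obtain ⟨τ, t, r, ht, hQ⟩ := h1
  obtain ⟨υ, t', r', ht', hQ'⟩ := h2 τ hQ
  obtain ⟨k, rfl⟩ : ∃ j, k = j + 1 := ⟨k - 1, by omega⟩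
  exact ⟨υ, t + t', .seq r r', add_le_pow_succ hy
    (ht.trans (Nat.pow_le_pow_right (by omega) (by omega)))
    (ht'.trans (Nat.pow_le_pow_right (by omega) (by omega))), hQ'⟩

theorem Within.cond (hy : 2 ≤ y) {b : Test} (h1 : b.Holds σ → Within y p σ k Q)
    (h2 : ¬ b.Holds σ → Within y q σ k Q) (hk : 6 ≤ k := by norm_num)
    (hc : b.cost ≤ 64 := by decide) : Within y (.cond b p q) σ (k + 1) Q := by
  have hc' := le_pow_of_le_64 hy hc hk
  by_cases hb : b.Holds σ
  · obtain ⟨τ, t, r, ht, hQ⟩ := h1 hb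
    exact ⟨τ, _, .condTrue hb r, add_le_pow_succ hy hc' ht, hQ⟩
  · obtain ⟨τ, t, r, ht, hQ⟩ := h2 hb
    exact ⟨τ, _, .condFalse hb r, add_le_pow_succ hy hc' ht, hQ⟩

/-- While loops, with an invariant and a decreasing measure. -/
theorem Within.loop (hy : 2 ≤ y) {b : Test} (I : Store → Prop) (m : Store → ℕ) {a : ℕ}
    (hσ : I σ) (hm : m σ ≤ y ^ a)
    (hstep : ∀ τ, I τ → b.Holds τ → Within y p τ k fun τ' => I τ' ∧ m τ' < m τ)
    (hk : 6 ≤ k := by norm_num) (hc : b.cost ≤ 64 := by decide) :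
    Within y (.loop b p) σ (a + k + 2) fun τ => I τ ∧ ¬ b.Holds τ := by
  have hc' := le_pow_of_le_64 hy hc hk
  have key : ∀ N σ, I σ → m σ ≤ N → ∃ τ t, Runs (.loop b p) σ τ t ∧
      t ≤ N * (b.cost + y ^ k) + b.cost ∧ I τ ∧ ¬ b.Holds τ := by
    intro N
    induction N with
    | zero =>
      intro σ hσ hm
      refine ⟨σ, _, .loopStop fun hb => ?_, by simp, hσ, fun hb => ?_⟩ <;>
      · obtain ⟨τ, t, -, -, -, h⟩ := hstep σ hσ hb
        omega
    | succ N ih =>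
      intro σ hσ hm
      by_cases hb : b.Holds σ
      · obtain ⟨τ, t, r, ht, hI, hlt⟩ := hstep σ hσ hb
        obtain ⟨υ, t', r', ht', hI', hb'⟩ := ih τ hI (by omega)
        refine ⟨υ, _, .loopStep hb r r', ?_, hI', hb'⟩
        rw [add_mul, one_mul]
        omega
      · exact ⟨σ, _, .loopStop hb, Nat.le_add_left _ _, hσ, hb⟩
  obtain ⟨τ, t, r, ht, hQ⟩ := key (y ^ a) σ hσ hm
  refine ⟨τ, t, r, ht.trans ?_, hQ⟩
  -- One iteration with its test takes `y ^ (k + 1)` steps, at most `y ^ a` iterations occur, and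
  -- the final failing test adds one more unit to the exponent.
  have h1 : b.cost + y ^ k ≤ y ^ (k + 1) := add_le_pow_succ hy hc' le_rfl
  refine add_le_pow_succ (k := a + k + 1) hy ?_ (le_pow_of_le_64 hy hc (by omega))
  calc y ^ a * (b.cost + y ^ k) ≤ y ^ a * y ^ (k + 1) := Nat.mul_le_mul_left _ h1
    _ = y ^ (a + k + 1) := by rw [← pow_add, add_assoc]

/-- The scalar variable number `a`. -/
def var (a : ℕ) : NatExpr := .read a (.const 0)

@[simp] theorem eval_var (a : ℕ) : (var a).eval σ = σ.nats a 0 := rfl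

/-- `for x < e do p`. -/
def forLoop (x : ℕ) (e : NatExpr) (p : Prog) : Prog :=
  .seq (.setNat x (.const 0) (.const 0))
    (.loop (.natLe (.add (var x) (.const 1)) e)
      (.seq p (.setNat x (.const 0) (.add (var x) (.const 1)))))

/-- The hypothesis `hI` keeps the invariant independent of the loop variable, whose value is tracked
separately. Of the five extra units, two come from sequencing (initialisation and increment) and
three from a loop with at most `N ≤ y ^ 1` iterations. -/
theorem Within.forLoop (hy : 2 ≤ y) {x : ℕ} {e : NatExpr} (N : ℕ) (I : ℕ → Store → Prop)
    (hN : N ≤ y) (hI : ∀ j τ v, I j τ → I j (τ.writeNat x 0 v))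
    (he : ∀ j τ, I j τ → e.eval τ = N) (h0 : I 0 σ)
    (hstep : ∀ j < N, ∀ τ, τ.nats x 0 = j → I j τ → Within y p τ k (I (j + 1)))
    (hk : 6 ≤ k := by norm_num) (hx : x ∉ p.natWrites := by decide)
    (hc : e.cost + 5 ≤ 64 := by decide) :
    Within y (forLoop x e p) σ (k + 5) (I N) := by
  refine Within.seq hy (k₁ := 6) (k₂ := k + 4)
    (Q' := fun τ => τ.nats x 0 = 0 ∧ I 0 τ) (.setNat hy ⟨by simp [NatExpr.eval], hI _ _ _ h0⟩)
    ?_ (by omega) (by omega)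
  rintro τ ⟨hτx, hτ⟩
  have hb : ∀ j υ, υ.nats x 0 = j → I j υ →
      ((Test.natLe (.add (var x) (.const 1)) e).Holds υ ↔ j + 1 ≤ N) := by
    intro j υ hυ hIυ
    simp only [Test.Holds, NatExpr.eval, eval_var, he j υ hIυ, hυ]
  have hloop := Within.loop (σ := τ) (k := k + 1) hy (a := 1)
    (b := .natLe (.add (var x) (.const 1)) e)
    (p := .seq p (.setNat x (.const 0) (.add (var x) (.const 1))))
    (fun υ => ∃ j ≤ N, υ.nats x 0 = j ∧ I j υ) (fun υ => N - υ.nats x 0)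
    ⟨0, Nat.zero_le _, hτx, hτ⟩ (by rw [pow_one]; omega) ?_ (by omega) ?_
  · rw [show 1 + (k + 1) + 2 = k + 4 by omega] at hloop
    refine hloop.imp ?_
    rintro υ ⟨⟨j, hj, hυ, hIυ⟩, hnot⟩
    rw [hb j υ hυ hIυ] at hnot
    obtain rfl : j = N := by omega
    exact hIυ
  · rintro υ ⟨j, hj, hυ, hIυ⟩ hholds
    rw [hb j υ hυ hIυ] at hholds
    refine Within.seq hy (hstep j (by omega) υ hυ hIυ).frame (k₂ := 6) ?_ (by omega) (by omega)
    rintro φ ⟨hφ, hfr, -⟩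
    have hφx : φ.nats x 0 = j := by rw [hfr x hx, hυ]
    refine .setNat hy ⟨⟨j + 1, hholds, ?_, ?_⟩, ?_⟩ (by simp [NatExpr.cost, var])
    · simp [NatExpr.eval, hφx]
    · exact hI _ _ _ hφ
    · simp [NatExpr.eval, hφx]
      omega
  · simp only [Test.cost, NatExpr.cost, var]
    omega

end Framework

/-! ### Preprocessing: shortest distances -/

section Distances

/-- Position of the entry `(u, v)` in a table whose row offsets are listed in integer array `3`. -/
def idx (u v : ℕ) : NatExpr := .add (.read 3 (var u)) (var v)

/-- Compute the row offsets of `n × n` tables. -/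
def rowProg : Prog :=
  forLoop 5 (var 0) (.setNat 3 (.add (var 5) (.const 1)) (.add (.read 3 (var 5)) (var 0)))

/-- The input size and the row offsets are in place. -/
def RowsReady (n : ℕ) (σ : Store) : Prop :=
  σ.nats 0 0 = n ∧ ∀ u ≤ n, σ.nats 3 u = u * n

theorem RowsReady.congr {n : ℕ} {σ τ : Store} (h : RowsReady n σ) (h0 : τ.nats 0 = σ.nats 0)
    (h3 : τ.nats 3 = σ.nats 3) : RowsReady n τ := by
  unfold RowsReady
  rw [h0, h3]
  exact h

theorem RowsReady.eval_idx {n : ℕ} {σ : Store} (h : RowsReady n σ) {u v : ℕ}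
    (hu : σ.nats u 0 ≤ n) : (idx u v).eval σ = σ.nats u 0 * n + σ.nats v 0 := by
  simp only [idx, NatExpr.eval, eval_var, h.2 _ hu]

variable {y n : ℕ} {σ : Store}

/-- Index arithmetic has no product, so offsets are accumulated by addition. The offset of row `0`
is never written and relies on the memory being zero initially. -/
theorem rowProg_spec (hy : 2 ≤ y) (hn : n ≤ y) (h0 : σ.nats 0 0 = n) (h3 : σ.nats 3 0 = 0) :
    Within y rowProg σ 11 (RowsReady n) := by
  refine Within.forLoop hy n (fun j τ => τ.nats 0 0 = n ∧ ∀ u ≤ j, τ.nats 3 u = u * n) hn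
    ?_ ?_ ?_ ?_
  · rintro j τ v ⟨h1, h2⟩
    exact ⟨by simpa using h1, by simpa using h2⟩
  · rintro j τ ⟨h1, -⟩
    simpa using h1
  · refine ⟨h0, fun u hu => ?_⟩
    obtain rfl : u = 0 := by omega
    simpa using h3
  · rintro j hj τ hτ ⟨h1, h2⟩
    refine .setNat hy ⟨by simpa using h1, fun u hu => ?_⟩
    simp only [Store.writeNat_nats, NatExpr.eval, eval_var, hτ, true_and, h1, h2 j le_rfl]
    split_ifs with hu'
    · rw [hu']; ring
    · exact h2 u (by omega)

theorem idx_inj {n u v u' v' : ℕ} (hv : v < n) (hv' : v' < n) :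
    u * n + v = u' * n + v' ↔ u = u' ∧ v = v' := by
  constructor
  · intro h
    have h1 : (u * n + v) / n = u := by
      rw [mul_comm, Nat.mul_add_div (by omega), Nat.div_eq_of_lt hv, add_zero]
    have h2 : (u' * n + v') / n = u' := by
      rw [mul_comm, Nat.mul_add_div (by omega), Nat.div_eq_of_lt hv', add_zero]
    have h3 : u = u' := by rw [← h1, h, h2]
    subst h3
    exact ⟨rfl, by omega⟩
  · rintro ⟨rfl, rfl⟩
    rfl

/-- Initial distance estimates: `0` on the diagonal, the weight on edges, `ρ + 1` elsewhere. -/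
def initProg : Prog :=
  forLoop 5 (var 0) (forLoop 6 (var 0)
    (.cond (.conj (.natLe (var 5) (var 6)) (.natLe (var 6) (var 5)))
      (.setReal 2 (idx 5 6) (.const 0))
      (.cond (.natLe (.const 1) (.read 1 (idx 5 6)))
        (.setReal 2 (idx 5 6) (.read 0 (idx 5 6)))
        (.setReal 2 (idx 5 6) (.add (.read 1 (.const 0)) (.const 1))))))

open Classical in
/-- The initial estimate of the distance from `u` to `v`. -/
noncomputable def initEntry (n : ℕ) (σ : Store) (u v : ℕ) : ℝ :=
  if u = v then 0 else if 1 ≤ σ.nats 1 (u * n + v) then σ.reals 0 (u * n + v)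
    else σ.reals 1 0 + 1

/-- The value `ρ + 1` plays the role of infinity: distances matter only through comparison with `ρ`.
-/
theorem initProg_spec (hy : 2 ≤ y) (hn : n ≤ y) (hσ : RowsReady n σ) :
    Within y initProg σ 18 fun τ =>
      ∀ u < n, ∀ v < n, τ.reals 2 (u * n + v) = initEntry n σ u v := by
  have hset : ∀ (τ : Store) (j k : ℕ) (e : RealExpr), j < n → k < n → RowsReady n τ →
      τ.nats 5 0 = j → τ.nats 6 0 = k →
      (∀ u < j, ∀ v < n, τ.reals 2 (u * n + v) = initEntry n σ u v) →
      (∀ v < k, τ.reals 2 (j * n + v) = initEntry n σ j v) →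
      e.eval τ = initEntry n σ j k →
      (∀ u < j, ∀ v < n, (τ.writeReal 2 ((idx 5 6).eval τ) (e.eval τ)).reals 2 (u * n + v) =
        initEntry n σ u v) ∧
      (∀ v < k + 1, (τ.writeReal 2 ((idx 5 6).eval τ) (e.eval τ)).reals 2 (j * n + v) =
        initEntry n σ j v) := by
    intro τ j k e hj hk hr h5 h6 hD hd he
    have hi : (idx 5 6).eval τ = j * n + k := by rw [hr.eval_idx (by omega), h5, h6]
    rw [hi, he]
    constructor
    · intro u hu v hv
      simp only [Store.writeReal_reals, true_and, idx_inj hv hk]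
      rw [if_neg (by omega)]
      exact hD u hu v hv
    · intro v hv
      simp only [Store.writeReal_reals, true_and, idx_inj (by omega : v < n) hk]
      split_ifs with h
      · rw [h]
      · exact hd v (by omega)
  refine (Within.forLoop hy n (fun j τ => RowsReady n τ ∧ τ.nats 1 = σ.nats 1 ∧
    τ.reals 0 = σ.reals 0 ∧ τ.reals 1 = σ.reals 1 ∧
    ∀ u < j, ∀ v < n, τ.reals 2 (u * n + v) = initEntry n σ u v) (k := 13) hn ?_ ?_ ?_ ?_).imp
      fun τ h => h.2.2.2.2
  · rintro j τ v ⟨h1, h2, h3⟩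
    exact ⟨h1.congr (by ext; simp) (by ext; simp), by rw [← h2]; ext; simp, h3⟩
  · rintro j τ ⟨h1, -⟩
    simpa using h1.1
  · exact ⟨hσ, rfl, rfl, rfl, fun u hu => by omega⟩
  rintro j hj τ hτ ⟨h1, h2, h3, h4, h5⟩
  refine (Within.forLoop hy n (fun k τ => τ.nats 5 0 = j ∧ RowsReady n τ ∧ τ.nats 1 = σ.nats 1 ∧
    τ.reals 0 = σ.reals 0 ∧ τ.reals 1 = σ.reals 1 ∧
    (∀ u < j, ∀ v < n, τ.reals 2 (u * n + v) = initEntry n σ u v) ∧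
    ∀ v < k, τ.reals 2 (j * n + v) = initEntry n σ j v) (k := 8) hn ?_ ?_ ?_ ?_).imp ?_
  · rintro k τ v ⟨h0, h1, h2, h3⟩
    exact ⟨by simpa using h0, h1.congr (by ext; simp) (by ext; simp), by rw [← h2]; ext; simp, h3⟩
  · rintro k τ ⟨-, h1, -⟩
    simpa using h1.1
  · exact ⟨hτ, h1, h2, h3, h4, h5, fun v hv => by omega⟩
  · rintro k hk τ h6 ⟨h0, h1, h2, h3, h4, h5, h5'⟩
    have hi : (idx 5 6).eval τ = j * n + k := by rw [h1.eval_idx (by omega), h0, h6]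
    refine Within.cond hy (fun hb => ?_) (fun hb => ?_)
    · refine Within.mono hy (Within.setReal hy ?_) (by norm_num : 6 ≤ 7)
      simp only [Test.Holds, eval_var, h0, h6] at hb
      exact ⟨h0, h1, h2, h3, h4, hset τ j k _ hj hk h1 h0 h6 h5 h5' (by
        simp [RealExpr.eval, initEntry, le_antisymm hb.1 hb.2])⟩
    · simp only [Test.Holds, eval_var, h0, h6] at hb
      have hjk : j ≠ k := fun h => hb ⟨h.le, h.ge⟩
      refine Within.cond (k := 6) hy (fun hb => Within.setReal hy ?_) (fun hb => Within.setReal hy ?_)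
      · simp only [Test.Holds, NatExpr.eval, hi, h2] at hb
        exact ⟨h0, h1, h2, h3, h4, hset τ j k _ hj hk h1 h0 h6 h5 h5' (by
          simp [RealExpr.eval, initEntry, hjk, hb, hi, h3])⟩
      · simp only [Test.Holds, NatExpr.eval, hi, h2] at hb
        exact ⟨h0, h1, h2, h3, h4, hset τ j k _ hj hk h1 h0 h6 h5 h5' (by
          simp [RealExpr.eval, initEntry, hjk, hb, h4, NatExpr.eval])⟩
  · rintro υ ⟨-, h1, h2, h3, h4, h5, h6⟩
    refine ⟨h1, h2, h3, h4, fun u hu v hv => ?_⟩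
    rcases Nat.lt_succ_iff_lt_or_eq.1 hu with hu | rfl
    · exact h5 u hu v hv
    · exact h6 v hv

/-- One pass of relaxations over all triples of vertices. -/
def relaxProg : Prog :=
  forLoop 5 (var 0) (forLoop 6 (var 0) (forLoop 7 (var 0)
    (.cond (.realLe (.add (.read 2 (idx 5 7)) (.read 2 (idx 7 6))) (.read 2 (idx 5 6)))
      (.setReal 2 (idx 5 6) (.add (.read 2 (idx 5 7)) (.read 2 (idx 7 6))))
      .skip)))

/-- The invariant of a pass of relaxations: `m` is a lower bound, `D₀` the table at the
beginning, and the pairs before `(j, k)` and the pair `(j, k)` for centers below `l` have been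
treated. -/
structure RelaxInv (n : ℕ) (m D₀ : ℕ → ℕ → ℝ) (j k l : ℕ) (D : ℕ → ℝ) : Prop where
  lower : ∀ u < n, ∀ v < n, m u v ≤ D (u * n + v)
  upper : ∀ u < n, ∀ v < n, D (u * n + v) ≤ D₀ u v
  done : ∀ u < n, ∀ v < n, ∀ z < n, (u < j ∨ u = j ∧ (v < k ∨ v = k ∧ z < l)) →
    D (u * n + v) ≤ D₀ u z + D₀ z v

/-- The table is updated in place. This is harmless because entries only decrease, so inequalities
already achieved persist and later sums read values at most those of `D₀`. The lower bound survives
because `m` satisfies the triangle inequality. -/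
theorem relaxProg_spec (hy : 2 ≤ y) (hn : n ≤ y) {m D₀ : ℕ → ℕ → ℝ}
    (hm : ∀ u < n, ∀ v < n, ∀ z < n, m u v ≤ m u z + m z v) (hσ : RowsReady n σ)
    (h0 : RelaxInv n m D₀ 0 0 0 (σ.reals 2)) :
    Within y relaxProg σ 22 fun τ => RelaxInv n m D₀ n 0 0 (τ.reals 2) := by
  refine (Within.forLoop hy n (fun j τ => RowsReady n τ ∧ RelaxInv n m D₀ j 0 0 (τ.reals 2))
    (k := 17) hn ?_ ?_ ⟨hσ, h0⟩ ?_).imp fun τ h => h.2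
  · rintro j τ v ⟨h1, h2⟩
    exact ⟨h1.congr (by ext; simp) (by ext; simp), h2⟩
  · rintro j τ ⟨h1, -⟩
    simpa using h1.1
  rintro j hj τ hτ ⟨h1, h2⟩
  refine (Within.forLoop hy n (fun k τ => τ.nats 5 0 = j ∧ RowsReady n τ ∧
    RelaxInv n m D₀ j k 0 (τ.reals 2)) (k := 12) hn ?_ ?_ ⟨hτ, h1, h2⟩ ?_).imp ?_
  · rintro k τ v ⟨h0, h1, h2⟩
    exact ⟨by simpa using h0, h1.congr (by ext; simp) (by ext; simp), h2⟩
  · rintro k τ ⟨-, h1, -⟩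
    simpa using h1.1
  swap
  · rintro υ ⟨-, h1, h2⟩
    refine ⟨h1, h2.lower, h2.upper, fun u hu v hv z hz h => h2.done u hu v hv z hz (by omega)⟩
  clear h1 h2
  rintro k hk τ hτ ⟨h0, h1, h2⟩
  refine (Within.forLoop hy n (fun l τ => τ.nats 5 0 = j ∧ τ.nats 6 0 = k ∧ RowsReady n τ ∧
    RelaxInv n m D₀ j k l (τ.reals 2)) (k := 7) hn ?_ ?_ ⟨h0, hτ, h1, h2⟩ ?_).imp ?_
  · rintro k τ v ⟨h0, h0', h1, h2⟩
    exact ⟨by simpa using h0, by simpa using h0', h1.congr (by ext; simp) (by ext; simp), h2⟩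
  · rintro k τ ⟨-, -, h1, -⟩
    simpa using h1.1
  swap
  · rintro υ ⟨h0, -, h1, h2⟩
    refine ⟨h0, h1, h2.lower, h2.upper, fun u hu v hv z hz h => h2.done u hu v hv z hz (by omega)⟩
  clear h0 h1 h2
  rintro l hl τ hτ ⟨h5, h6, h1, h2⟩
  have hi : (idx 5 6).eval τ = j * n + k := by rw [h1.eval_idx (by omega), h5, h6]
  have hi1 : (idx 5 7).eval τ = j * n + l := by rw [h1.eval_idx (by omega), h5, hτ]
  have hi2 : (idx 7 6).eval τ = l * n + k := by rw [h1.eval_idx (by omega), h6, hτ]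
  refine Within.cond hy (fun hb => Within.setReal hy ⟨h5, h6, h1, ?_⟩)
    (fun hb => Within.skip hy ⟨h5, h6, h1, ?_⟩)
  · simp only [Test.Holds, RealExpr.eval, hi, hi1, hi2] at hb ⊢
    have hle : ∀ u < n, ∀ v < n, (τ.writeReal 2 (j * n + k)
        (τ.reals 2 (j * n + l) + τ.reals 2 (l * n + k))).reals 2 (u * n + v) ≤
        τ.reals 2 (u * n + v) := by
      intro u hu v hv
      simp only [Store.writeReal_reals, true_and, idx_inj hv hk]
      split_ifs with h
      · rw [h.1, h.2]; exact hb
      · exact le_rfl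
    refine ⟨fun u hu v hv => ?_, fun u hu v hv => (hle u hu v hv).trans (h2.upper u hu v hv),
      fun u hu v hv z hz h => ?_⟩
    · simp only [Store.writeReal_reals, true_and, idx_inj hv hk]
      split_ifs with h
      · rw [h.1, h.2]
        exact (hm j hj k hk l hl).trans (add_le_add (h2.lower j hj l hl) (h2.lower l hl k hk))
      · exact h2.lower u hu v hv
    · by_cases hnew : u = j ∧ v = k ∧ z = l
      · obtain ⟨rfl, rfl, rfl⟩ := hnew
        simp only [Store.writeReal_reals, and_self, if_true]
        exact add_le_add (h2.upper u hu z hz) (h2.upper z hz v hv)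
      · exact (hle u hu v hv).trans (h2.done u hu v hv z hz (by omega))
  · simp only [Test.Holds, RealExpr.eval, hi, hi1, hi2, not_le] at hb
    refine ⟨h2.lower, h2.upper, fun u hu v hv z hz h => ?_⟩
    by_cases hnew : u = j ∧ v = k ∧ z = l
    · obtain ⟨rfl, rfl, rfl⟩ := hnew
      exact hb.le.trans (add_le_add (h2.upper u hu z hz) (h2.upper z hz v hv))
    · exact h2.done u hu v hv z hz (by omega)

/-- Repeat the relaxations `n` times. -/
def distProg : Prog := forLoop 8 (var 0) relaxProg

/-- The table decides which pairs are at distance at most `ρ`. -/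
def DistReady {n : ℕ} (G : SimpleGraph (Fin n)) (w : Sym2 (Fin n) → ℝ≥0) (ρ : ℝ) (σ : Store) :
    Prop :=
  ∀ u v : Fin n, σ.reals 2 (u * n + v) ≤ ρ ↔ (wdist G w u v : ℝ) ≤ ρ

theorem distProg_spec (hy : 2 ≤ y) (hn : n ≤ y) {G : SimpleGraph (Fin n)} (hG : G.Connected)
    {w : Sym2 (Fin n) → ℝ≥0} {ρ : ℝ} (hρ : 0 < ρ) (hσ : RowsReady n σ)
    (hdiag : ∀ u : Fin n, σ.reals 2 (u * n + u) = 0)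
    (hedge : ∀ u v : Fin n, G.Adj u v → σ.reals 2 (u * n + v) = w s(u, v))
    (hfar : ∀ u v : Fin n, u ≠ v → ¬ G.Adj u v → σ.reals 2 (u * n + v) = ρ + 1) :
    Within y distProg σ 27 (DistReady G w ρ) := by
  classical
  -- The distance truncated at `ρ + 1` still satisfies the triangle inequality, and it bounds from
  -- below also the entries initialised with `ρ + 1`.
  let m : ℕ → ℕ → ℝ := fun u v => if h : u < n ∧ v < n then
    min (wdist G w ⟨u, h.1⟩ ⟨v, h.2⟩ : ℝ) (ρ + 1) else 0
  have hmdef : ∀ u v : Fin n, m u v = min (wdist G w u v : ℝ) (ρ + 1) := by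
    intro u v; simp [m]
  have hm : ∀ u < n, ∀ v < n, ∀ z < n, m u v ≤ m u z + m z v := by
    intro u hu v hv z hz
    have h1 := hmdef ⟨u, hu⟩ ⟨v, hv⟩
    have h2 := hmdef ⟨u, hu⟩ ⟨z, hz⟩
    have h3 := hmdef ⟨z, hz⟩ ⟨v, hv⟩
    simp only at h1 h2 h3
    rw [h1, h2, h3]
    have h4 : (wdist G w ⟨u, hu⟩ ⟨v, hv⟩ : ℝ) ≤
        wdist G w ⟨u, hu⟩ ⟨z, hz⟩ + wdist G w ⟨z, hz⟩ ⟨v, hv⟩ := by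
      exact_mod_cast wdist_triangle hG _ _ _
    have h5 := (wdist G w ⟨u, hu⟩ ⟨z, hz⟩).coe_nonneg
    have h6 := (wdist G w ⟨z, hz⟩ ⟨v, hv⟩).coe_nonneg
    rcases min_cases (wdist G w ⟨u, hu⟩ ⟨v, hv⟩ : ℝ) (ρ + 1) with h | h <;>
    rcases min_cases (wdist G w ⟨u, hu⟩ ⟨z, hz⟩ : ℝ) (ρ + 1) with h' | h' <;>
    rcases min_cases (wdist G w ⟨z, hz⟩ ⟨v, hv⟩ : ℝ) (ρ + 1) with h'' | h'' <;>
    linarith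
  -- after `j` passes the table is a lower bound for all walks with at most `j + 1` edges
  refine (Within.forLoop hy n (fun j τ => RowsReady n τ ∧
    (∀ u < n, ∀ v < n, m u v ≤ τ.reals 2 (u * n + v)) ∧
    ∀ (u v : Fin n) (p : G.Walk u v), p.length ≤ j + 1 →
      τ.reals 2 (u * n + v) ≤ walkWeight w p) (k := 22) hn ?_ ?_ ⟨hσ, ?_, ?_⟩ ?_).imp ?_
  · rintro j τ v ⟨h1, h2⟩
    exact ⟨h1.congr (by ext; simp) (by ext; simp), h2⟩
  · rintro j τ ⟨h1, -⟩
    simpa using h1.1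
  · intro u hu v hv
    have h1 := hmdef ⟨u, hu⟩ ⟨v, hv⟩
    have h2 := hdiag ⟨u, hu⟩
    have h3 := hedge ⟨u, hu⟩ ⟨v, hv⟩
    have h4 := hfar ⟨u, hu⟩ ⟨v, hv⟩
    simp only at h1 h2 h3 h4
    rw [h1]
    by_cases huv : u = v
    · subst huv
      rw [h2, wdist_self]
      exact min_le_left _ _
    by_cases hadj : G.Adj ⟨u, hu⟩ ⟨v, hv⟩
    · rw [h3 hadj]
      refine (min_le_left _ _).trans ?_
      have := wdist_le (w := w) (SimpleGraph.Walk.cons hadj .nil)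
      rw [walkWeight_cons, walkWeight_nil, add_zero] at this
      exact_mod_cast this
    · rw [h4 (by simpa using huv) hadj]
      exact min_le_right _ _
  · intro u v p hp
    cases p with
    | nil => rw [hdiag]; simp
    | cons h p =>
      cases p with
      | nil => rw [hedge _ _ h]; simp
      | cons h' p => simp at hp
  · rintro j hj τ - ⟨h1, h2, h3⟩
    refine (relaxProg_spec (D₀ := fun u v => τ.reals 2 (u * n + v)) hy hn hm h1
      ⟨h2, fun u hu v hv => le_rfl, fun u hu v hv z hz h => by omega⟩).frame.imp ?_
    rintro υ ⟨h4, hfr, -⟩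
    refine ⟨h1.congr (hfr 0 (by decide)) (hfr 3 (by decide)), h4.lower, fun u v p hp => ?_⟩
    by_cases hp' : p.length ≤ j + 1
    · exact (h4.upper u u.2 v v.2).trans (h3 u v p hp')
    cases p with
    | nil => simp at hp'
    | @cons _ z _ h p =>
      rw [SimpleGraph.Walk.length_cons] at hp
      -- Relaxing at the second vertex `z` of the walk combines its first edge with the remaining
      -- walk, which the previous pass has handled.
      refine (h4.done u u.2 v v.2 z z.2 (Or.inl u.2)).trans ?_
      have h5 := h3 u z (.cons h .nil) (by simp)
      have h6 := h3 z v p (by omega)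
      rw [walkWeight_cons, walkWeight_nil, add_zero] at h5
      rw [walkWeight_cons]
      push_cast
      exact add_le_add h5 h6
  · rintro τ ⟨-, h1, h2⟩ u v
    constructor
    · intro h
      have h3 := (h1 u u.2 v v.2).trans h
      rw [hmdef] at h3
      rcases min_le_iff.1 h3 with h3 | h3
      · exact h3
      · linarith
    · intro h
      obtain ⟨p, hp⟩ := exists_shortest hG w u v
      -- A shortest path has fewer than `n` edges, so `n` passes suffice.
      have h3 : p.bypass.length ≤ n + 1 := by
        have := p.bypass_isPath.length_lt
        rw [Fintype.card_fin] at this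
        omega
      refine (h2 u v p.bypass h3).trans (le_trans ?_ h)
      rw [← hp]
      exact_mod_cast walkWeight_bypass_le p

end Distances

/-! ### The local search program -/

section Search

variable {y n : ℕ} {σ : Store}

/-- Compute `⌈K / ε ^ 2⌉` by counting. -/
def sizeProg (K : ℕ) : Prog :=
  .seq (.setNat 9 (.const 0) (.const 0)) (.seq (.setReal 3 (.const 0) (.const 0))
    (.loop (.neg (.realLe (.const K) (.read 3 (.const 0))))
      (.seq (.setReal 3 (.const 0) (.add (.read 3 (.const 0))
          (.mul (.read 1 (.const 1)) (.read 1 (.const 1)))))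
        (.setNat 9 (.const 0) (.add (var 9) (.const 1))))))

/-- Reals cannot be converted to integers, so the ceiling is found by counting how often `ε ^ 2`
must be added to reach `K`. -/
theorem sizeProg_spec (hy : 2 ≤ y) (K : ℕ) {ε : ℝ} (hε : 0 < ε) (hσ : σ.reals 1 1 = ε)
    (hs : ⌈(K : ℝ) / ε ^ 2⌉₊ ≤ y) :
    Within y (sizeProg K) σ 12 fun τ => τ.nats 9 0 = ⌈(K : ℝ) / ε ^ 2⌉₊ := by
  have hε2 : 0 < ε ^ 2 := by positivity
  refine Within.seq hy (Q' := fun τ => τ.nats 9 0 = 0 ∧ τ.reals 1 1 = ε)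
    (.setNat hy ⟨by simp [NatExpr.eval], by simpa using hσ⟩) (k₂ := 11) ?_
  rintro τ ⟨h1, h2⟩
  refine Within.seq hy (Q' := fun τ => τ.nats 9 0 = 0 ∧ τ.reals 1 1 = ε ∧ τ.reals 3 0 = 0)
    (.setReal hy ⟨by simpa using h1, by simpa using h2, by simp [NatExpr.eval, RealExpr.eval]⟩)
    (k₂ := 10) ?_
  clear h1 h2
  rintro τ ⟨h1, h2, h3⟩
  refine (Within.loop (a := 1) (k := 7) hy (fun τ => τ.reals 1 1 = ε ∧
    τ.reals 3 0 = τ.nats 9 0 * ε ^ 2 ∧ τ.nats 9 0 ≤ ⌈(K : ℝ) / ε ^ 2⌉₊)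
    (fun τ => ⌈(K : ℝ) / ε ^ 2⌉₊ - τ.nats 9 0) ⟨h2, by simp [h1, h3], by simp [h1]⟩
    (by rw [pow_one]; omega) ?_ (by norm_num)
    (by simp [Test.cost, RealExpr.cost, NatExpr.cost])).imp ?_
  · rintro υ ⟨h1, h2, h3⟩ hb
    simp only [Test.Holds, RealExpr.eval, NatExpr.eval, h2, not_le] at hb
    have hlt : υ.nats 9 0 < ⌈(K : ℝ) / ε ^ 2⌉₊ := by
      rw [Nat.lt_ceil, lt_div_iff₀ hε2]
      exact hb
    refine Within.seq hy (k₁ := 6) (k₂ := 6) (Q' := fun τ => τ.reals 1 1 = ε ∧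
      τ.reals 3 0 = (υ.nats 9 0 + 1) * ε ^ 2 ∧ τ.nats 9 0 = υ.nats 9 0) (.setReal hy ⟨?_, ?_, rfl⟩) ?_
    · simpa using h1
    · simp only [Store.writeReal_reals, NatExpr.eval, RealExpr.eval, h1, h2, and_self, if_true]
      ring
    · rintro φ ⟨h4, h5, h6⟩
      refine .setNat hy ⟨⟨by simpa using h4, ?_, ?_⟩, ?_⟩
      · simp [NatExpr.eval, h5, h6]
      · simpa [NatExpr.eval, h6] using hlt
      · simp [NatExpr.eval, h6]
        omega
  · rintro υ ⟨⟨-, h2, h3⟩, hb⟩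
    simp only [Test.Holds, RealExpr.eval, NatExpr.eval, h2, not_not] at hb
    refine le_antisymm h3 (Nat.ceil_le.2 ?_)
    rwa [div_le_iff₀ hε2]

/-- Compute the number `n ^ s` of codes of swaps. -/
def powProg : Prog :=
  .seq (.setNat 10 (.const 0) (.const 1)) (forLoop 5 (var 9)
    (.seq (.setNat 17 (.const 0) (.const 0))
      (.seq (forLoop 6 (var 0) (.setNat 17 (.const 0) (.add (var 17) (var 10))))
        (.setNat 10 (.const 0) (var 17)))))

theorem powProg_spec (hy : 2 ≤ y) (hn : n ≤ y) {s : ℕ} (hs : s ≤ y) (h0 : σ.nats 0 0 = n)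
    (h9 : σ.nats 9 0 = s) : Within y powProg σ 19 fun τ => τ.nats 10 0 = n ^ s := by
  refine Within.seq hy (Q' := fun τ => τ.nats 0 0 = n ∧ τ.nats 9 0 = s ∧ τ.nats 10 0 = 1)
    (.setNat hy ⟨by simpa using h0, by simpa using h9, by simp [NatExpr.eval]⟩) (k₂ := 18) ?_
  rintro τ ⟨h0, h9, h10⟩
  refine (Within.forLoop hy s (k := 13) (fun j τ => τ.nats 0 0 = n ∧ τ.nats 9 0 = s ∧
    τ.nats 10 0 = n ^ j) hs ?_ ?_ ⟨h0, h9, by simpa using h10⟩ ?_).imp fun τ h => h.2.2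
  · rintro j τ v ⟨h0, h9, h10⟩
    exact ⟨by simpa using h0, by simpa using h9, by simpa using h10⟩
  · rintro j τ ⟨-, h9, -⟩
    simpa using h9
  clear h0 h9 h10
  rintro j hj τ - ⟨h0, h9, h10⟩
  refine Within.seq hy (Q' := fun τ => τ.nats 0 0 = n ∧ τ.nats 9 0 = s ∧ τ.nats 10 0 = n ^ j ∧
    τ.nats 17 0 = 0) (.setNat hy ⟨by simpa using h0, by simpa using h9, by simpa using h10,
      by simp [NatExpr.eval]⟩) (k₂ := 12) ?_
  clear h0 h9 h10
  rintro τ ⟨h0, h9, h10, h17⟩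
  refine Within.seq hy (k₁ := 11) (k₂ := 6)
    (Within.forLoop hy n (k := 6) (fun k τ => τ.nats 0 0 = n ∧ τ.nats 9 0 = s ∧
      τ.nats 10 0 = n ^ j ∧ τ.nats 17 0 = k * n ^ j) hn ?_ ?_ ⟨h0, h9, h10, by simpa using h17⟩ ?_) ?_
  · rintro j τ v ⟨h0, h9, h10, h17⟩
    exact ⟨by simpa using h0, by simpa using h9, by simpa using h10, by simpa using h17⟩
  · rintro j τ ⟨h0, -⟩
    simpa using h0
  · rintro k hk τ - ⟨h0, h9, h10, h17⟩
    refine .setNat hy ⟨by simpa using h0, by simpa using h9, by simpa using h10, ?_⟩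
    simp [NatExpr.eval, h10, h17, add_mul]
  · rintro υ ⟨h0, h9, h10, h17⟩
    refine .setNat hy ⟨by simpa using h0, by simpa using h9, ?_⟩
    simp [NatExpr.eval, h17, pow_succ, mul_comm]

/-- Copy `n` cells of integer array `a` to array `b`. -/
def copyProg (a b : ℕ) : Prog :=
  forLoop 5 (var 0) (.setNat b (var 5) (.read a (var 5)))

theorem copyProg_spec (hy : 2 ≤ y) (hn : n ≤ y) {a b : ℕ} (hab : a ≠ b) (hb : 5 ≠ b)
    (hb0 : 0 ≠ b) (ha : a ≠ 5) (h0 : σ.nats 0 0 = n) :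
    Within y (copyProg a b) σ 11 fun τ => ∀ v < n, τ.nats b v = σ.nats a v := by
  refine (Within.forLoop hy n (k := 6) (fun j τ => τ.nats 0 0 = n ∧ τ.nats a = σ.nats a ∧
    ∀ v < j, τ.nats b v = σ.nats a v) hn ?_ ?_ ⟨h0, rfl, fun v hv => by omega⟩ ?_ (by norm_num)
    (by simpa [Prog.natWrites] using hb)).imp fun τ h => h.2.2
  · rintro j τ v ⟨h0, h1, h2⟩
    exact ⟨by simpa using h0, by rw [← h1]; ext; simp [ha], by simpa [hb.symm] using h2⟩
  · rintro j τ ⟨h0, -⟩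
    simpa using h0
  · rintro j hj τ h5 ⟨h0, h1, h2⟩
    refine .setNat hy ⟨by simpa [hb0] using h0, by rw [← h1]; ext; simp [hab], fun v hv => ?_⟩
      (by simp [NatExpr.cost, var])
    simp only [Store.writeNat_nats, NatExpr.eval, eval_var, h5, true_and, h1]
    split_ifs with h
    · rw [h]
    · exact h2 v (by omega)

/-- Divide the variable `12` by `n`, with the remainder in `12` and the quotient in `13`. -/
def divProg : Prog :=
  .seq (.setNat 13 (.const 0) (.const 0)) (.loop (.natLe (var 0) (var 12))
    (.seq (.setNat 12 (.const 0) (.sub (var 12) (var 0)))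
      (.setNat 13 (.const 0) (.add (var 13) (.const 1)))))

theorem divProg_spec (hy : 2 ≤ y) (hn : 0 < n) {c : ℕ} (hc : c ≤ y) (h0 : σ.nats 0 0 = n)
    (h12 : σ.nats 12 0 = c) :
    Within y divProg σ 11 fun τ => τ.nats 12 0 = c % n ∧ τ.nats 13 0 = c / n := by
  refine Within.seq hy (Q' := fun τ => τ.nats 0 0 = n ∧ τ.nats 12 0 = c ∧ τ.nats 13 0 = 0)
    (.setNat hy ⟨by simpa using h0, by simpa using h12, by simp [NatExpr.eval]⟩) (k₂ := 10) ?_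
  rintro τ ⟨h0, h12, h13⟩
  refine (Within.loop hy (a := 1) (k := 7) (fun τ => τ.nats 0 0 = n ∧
    n * τ.nats 13 0 + τ.nats 12 0 = c) (fun τ => τ.nats 12 0) ⟨h0, by simp [h12, h13]⟩
    (by simpa [h12] using hc) ?_).imp ?_
  · rintro υ ⟨h0, h1⟩ hb
    simp only [Test.Holds, eval_var, h0] at hb
    refine Within.seq hy (k₁ := 6) (k₂ := 6) (Q' := fun τ => τ.nats 0 0 = n ∧
      τ.nats 12 0 = υ.nats 12 0 - n ∧ τ.nats 13 0 = υ.nats 13 0)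
      (.setNat hy ⟨by simpa using h0, by simp [NatExpr.eval, h0], by simp⟩) ?_
    rintro φ ⟨h2, h3, h4⟩
    refine .setNat hy ⟨⟨by simpa using h2, ?_⟩, ?_⟩
    · simp only [Store.writeNat_nats, NatExpr.eval, eval_var, h3, h4]
      norm_num
      rw [mul_add, mul_one]
      omega
    · simp [h3]
      omega
  · rintro υ ⟨⟨h0, h1⟩, hb⟩
    simp only [Test.Holds, eval_var, h0, not_le] at hb
    rw [← h1]
    exact ⟨by rw [Nat.mul_add_mod, Nat.mod_eq_of_lt hb],
      by rw [Nat.mul_add_div hn, Nat.div_eq_of_lt hb, add_zero]⟩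

/-- The first `s` base-`n` digits of `c`, as a set of vertices. -/
def digitSet (n s c : ℕ) : Finset (Fin n) :=
  Finset.univ.filter fun v => ∃ i < s, c / n ^ i % n = v

/-- The array `a` is the indicator function of `S`. -/
def Represents (S : Finset (Fin n)) (a : ℕ → ℕ) : Prop :=
  ∀ v : Fin n, a v = if v ∈ S then 1 else 0

/-- Flip the cells of array `4` at the digits of variable `12`. -/
def flipProg : Prog :=
  forLoop 18 (var 9) (.seq divProg (.seq
    (.setNat 4 (var 12) (.sub (.const 1) (.read 2 (var 12)))) (.setNat 12 (.const 0) (var 13))))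

/-- Each flipped cell is computed from array `2`, which still holds `S`, and not from array `4`. A
digit that occurs repeatedly therefore flips its vertex only once, in accordance with `digitSet`. -/
theorem flipProg_spec (hy : 2 ≤ y) (hn : 0 < n) {s c : ℕ} (hs : s ≤ y) (hc : c ≤ y)
    (h0 : σ.nats 0 0 = n) (h9 : σ.nats 9 0 = s) (h12 : σ.nats 12 0 = c) {S : Finset (Fin n)}
    (h2 : Represents S (σ.nats 2)) (h4 : Represents S (σ.nats 4)) :
    Within y flipProg σ 17 fun τ => Represents (symmDiff S (digitSet n s c)) (τ.nats 4) := by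
  refine (Within.forLoop hy s (k := 12) (fun j τ => τ.nats 0 0 = n ∧ τ.nats 9 0 = s ∧
    τ.nats 2 = σ.nats 2 ∧ τ.nats 12 0 = c / n ^ j ∧
    Represents (symmDiff S (digitSet n j c)) (τ.nats 4)) hs ?_ ?_
    ⟨h0, h9, rfl, by simpa using h12, ?_⟩ ?_).imp fun τ h => h.2.2.2.2
  · rintro j τ v ⟨h0, h9, h2, h12, h4⟩
    exact ⟨by simpa using h0, by simpa using h9, by rw [← h2]; ext; simp, by simpa using h12,
      by simpa [Represents] using h4⟩
  · rintro j τ ⟨-, h9, -⟩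
    simpa using h9
  · have : digitSet n 0 c = ⊥ := by simp [digitSet]
    rwa [this, symmDiff_bot]
  rintro j hj τ - ⟨h0', h9', h2', h12', h4'⟩
  refine Within.seq hy (divProg_spec hy hn (c := c / n ^ j)
    ((Nat.div_le_self _ _).trans hc) h0' h12').frame (k₂ := 7) ?_
  rintro υ ⟨⟨hr, hq⟩, hfr, -⟩
  have e0 : υ.nats 0 0 = n := by rw [hfr 0 (by decide), h0']
  have e9 : υ.nats 9 0 = s := by rw [hfr 9 (by decide), h9']
  have e2 : υ.nats 2 = σ.nats 2 := by rw [hfr 2 (by decide), h2']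
  have e4 : υ.nats 4 = τ.nats 4 := hfr 4 (by decide)
  refine Within.seq hy (k₁ := 6) (k₂ := 6) (Q' := fun τ => τ.nats 0 0 = n ∧ τ.nats 9 0 = s ∧
    τ.nats 2 = σ.nats 2 ∧ τ.nats 13 0 = c / n ^ (j + 1) ∧
    Represents (symmDiff S (digitSet n (j + 1) c)) (τ.nats 4))
    (.setNat hy ⟨by simpa using e0, by simpa using e9, by rw [← e2]; ext; simp, ?_, ?_⟩) ?_
  · simp [hq, pow_succ, Nat.div_div_eq_div_mul]
  · intro v
    have hmod : c / n ^ j % n < n := Nat.mod_lt _ hn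
    have hd : v ∈ digitSet n (j + 1) c ↔ v ∈ digitSet n j c ∨ c / n ^ j % n = v := by
      simp only [digitSet, Finset.mem_filter, Finset.mem_univ, true_and, Nat.lt_succ_iff_lt_or_eq]
      constructor
      · rintro ⟨i, hi | rfl, h⟩
        · exact Or.inl ⟨i, hi, h⟩
        · exact Or.inr h
      · rintro (⟨i, hi, h⟩ | h)
        · exact ⟨i, Or.inl hi, h⟩
        · exact ⟨j, Or.inr rfl, h⟩
    simp only [Store.writeNat_nats, NatExpr.eval, eval_var, hr, true_and, e2, e4]
    by_cases hv : (v : ℕ) = c / n ^ j % n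
    · rw [if_pos hv, ← hv, h2 v]
      have : v ∈ digitSet n (j + 1) c := hd.2 (Or.inr hv.symm)
      by_cases hvS : v ∈ S <;> simp [Finset.mem_symmDiff, hvS, this]
    · rw [if_neg hv, h4' v]
      have : v ∈ digitSet n (j + 1) c ↔ v ∈ digitSet n j c := by
        rw [hd]
        exact or_iff_left (fun h => hv h.symm)
      simp only [Finset.mem_symmDiff, this]
  · rintro φ ⟨f0, f9, f2, f13, f4⟩
    exact .setNat hy ⟨by simpa using f0, by simpa using f9, by rw [← f2]; ext; simp,
      by simpa [NatExpr.eval] using f13, by simpa [Represents] using f4⟩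

/-- Test for a violation of independence in array `4`. -/
def badTest : Test :=
  .conj (.natLe (.const 1) (.read 4 (var 5))) (.conj (.natLe (.const 1) (.read 4 (var 6)))
    (.conj (.neg (.conj (.natLe (var 5) (var 6)) (.natLe (var 6) (var 5))))
      (.realLe (.read 2 (idx 5 6)) (.read 1 (.const 0)))))

/-- Count the sets in the arrays `2` and `4`, and test whether the latter is independent. -/
def checkProg : Prog :=
  .seq (.setNat 14 (.const 0) (.const 1)) (.seq (.setNat 15 (.const 0) (.const 0))
    (.seq (.setNat 16 (.const 0) (.const 0)) (forLoop 5 (var 0)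
      (.seq (.setNat 15 (.const 0) (.add (var 15) (.read 2 (var 5))))
        (.seq (.setNat 16 (.const 0) (.add (var 16) (.read 4 (var 5))))
          (forLoop 6 (var 0) (.cond badTest (.setNat 14 (.const 0) (.const 0)) .skip)))))))

/-- The pair `(u, v)` violates independence. -/
def BadPair (n : ℕ) (σ : Store) (u v : ℕ) : Prop :=
  1 ≤ σ.nats 4 u ∧ 1 ≤ σ.nats 4 v ∧ u ≠ v ∧ σ.reals 2 (u * n + v) ≤ σ.reals 1 0

theorem checkProg_loop_spec (hy : 2 ≤ y) (hn : n ≤ y) (hσ : RowsReady n σ) :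
    Within y checkProg σ 22 fun τ => (1 ≤ τ.nats 14 0 ↔ ∀ u < n, ∀ v < n, ¬ BadPair n σ u v) ∧
      τ.nats 15 0 = ∑ u ∈ Finset.range n, σ.nats 2 u ∧
      τ.nats 16 0 = ∑ u ∈ Finset.range n, σ.nats 4 u := by
  -- the part of the memory that does not change
  let Fix : Store → Prop := fun τ => RowsReady n τ ∧ τ.nats 2 = σ.nats 2 ∧ τ.nats 4 = σ.nats 4 ∧
    τ.reals = σ.reals
  have hFix : ∀ τ a i v, a ≠ 0 → a ≠ 2 → a ≠ 3 → a ≠ 4 → Fix τ → Fix (τ.writeNat a i v) := by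
    rintro τ a i v h0 h2 h3 h4 ⟨f0, f2, f4, fr⟩
    exact ⟨f0.congr (by ext; simp [h0.symm]) (by ext; simp [h3.symm]),
      by rw [← f2]; ext; simp [h2.symm], by rw [← f4]; ext; simp [h4.symm], fr⟩
  refine Within.seq hy (k₂ := 21) (Q' := fun τ => Fix τ ∧ τ.nats 14 0 = 1) (.setNat hy
    ⟨hFix _ _ _ _ (by norm_num) (by norm_num) (by norm_num) (by norm_num) ⟨hσ, rfl, rfl, rfl⟩,
      by simp [NatExpr.eval]⟩) ?_
  rintro τ ⟨hF, h14⟩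
  refine Within.seq hy (k₂ := 20) (Q' := fun τ => Fix τ ∧ τ.nats 14 0 = 1 ∧ τ.nats 15 0 = 0)
    (.setNat hy ⟨hFix _ _ _ _ (by norm_num) (by norm_num) (by norm_num) (by norm_num) hF,
      by simpa using h14, by simp [NatExpr.eval]⟩) ?_
  clear hF h14
  rintro τ ⟨hF, h14, h15⟩
  refine Within.seq hy (k₂ := 19) (Q' := fun τ => Fix τ ∧ τ.nats 14 0 = 1 ∧ τ.nats 15 0 = 0 ∧
    τ.nats 16 0 = 0)
    (.setNat hy ⟨hFix _ _ _ _ (by norm_num) (by norm_num) (by norm_num) (by norm_num) hF,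
      by simpa using h14, by simpa using h15, by simp [NatExpr.eval]⟩) ?_
  clear hF h14 h15
  rintro τ ⟨hF, h14, h15, h16⟩
  refine (Within.forLoop hy n (k := 14) (fun j τ => Fix τ ∧
    (1 ≤ τ.nats 14 0 ↔ ∀ u < j, ∀ v < n, ¬ BadPair n σ u v) ∧
    τ.nats 15 0 = ∑ u ∈ Finset.range j, σ.nats 2 u ∧
    τ.nats 16 0 = ∑ u ∈ Finset.range j, σ.nats 4 u) hn ?_ ?_ ⟨hF, by simp [h14], by simp [h15],
      by simp [h16]⟩ ?_).imp fun τ h => h.2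
  · rintro j τ v ⟨hF, h14, h15, h16⟩
    exact ⟨hFix _ _ _ _ (by norm_num) (by norm_num) (by norm_num) (by norm_num) hF,
      by simpa using h14, by simpa using h15, by simpa using h16⟩
  · rintro j τ ⟨hF, -⟩
    simpa using hF.1.1
  clear hF h14 h15 h16
  rintro j hj τ h5 ⟨hF, h14, h15, h16⟩
  refine Within.seq hy (k₂ := 13) (Q' := fun τ => Fix τ ∧ τ.nats 5 0 = j ∧
    (1 ≤ τ.nats 14 0 ↔ ∀ u < j, ∀ v < n, ¬ BadPair n σ u v) ∧
    τ.nats 15 0 = ∑ u ∈ Finset.range (j + 1), σ.nats 2 u ∧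
    τ.nats 16 0 = ∑ u ∈ Finset.range j, σ.nats 4 u)
    (.setNat hy ⟨hFix _ _ _ _ (by norm_num) (by norm_num) (by norm_num) (by norm_num) hF,
      by simpa using h5, by simpa using h14,
      by simp [NatExpr.eval, Finset.sum_range_succ, h15, h5, hF.2.1], by simpa using h16⟩) ?_
  clear hF h5 h14 h15 h16
  rintro τ ⟨hF, h5, h14, h15, h16⟩
  refine Within.seq hy (k₂ := 12) (Q' := fun τ => Fix τ ∧ τ.nats 5 0 = j ∧
    (1 ≤ τ.nats 14 0 ↔ ∀ u < j, ∀ v < n, ¬ BadPair n σ u v) ∧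
    τ.nats 15 0 = ∑ u ∈ Finset.range (j + 1), σ.nats 2 u ∧
    τ.nats 16 0 = ∑ u ∈ Finset.range (j + 1), σ.nats 4 u)
    (.setNat hy ⟨hFix _ _ _ _ (by norm_num) (by norm_num) (by norm_num) (by norm_num) hF,
      by simpa using h5, by simpa using h14, by simpa using h15,
      by simp [NatExpr.eval, Finset.sum_range_succ, h16, h5, hF.2.2.1]⟩) ?_
  clear hF h5 h14 h15 h16
  rintro τ ⟨hF, h5, h14, h15, h16⟩
  refine (Within.forLoop hy n (k := 7) (fun k τ => Fix τ ∧ τ.nats 5 0 = j ∧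
    (1 ≤ τ.nats 14 0 ↔ (∀ u < j, ∀ v < n, ¬ BadPair n σ u v) ∧ ∀ v < k, ¬ BadPair n σ j v) ∧
    τ.nats 15 0 = ∑ u ∈ Finset.range (j + 1), σ.nats 2 u ∧
    τ.nats 16 0 = ∑ u ∈ Finset.range (j + 1), σ.nats 4 u) hn ?_ ?_
    ⟨hF, h5, by simpa using h14, h15, h16⟩ ?_).imp ?_
  · rintro k τ v ⟨hF, h5, h14, h15, h16⟩
    exact ⟨hFix _ _ _ _ (by norm_num) (by norm_num) (by norm_num) (by norm_num) hF,
      by simpa using h5, by simpa using h14, by simpa using h15, by simpa using h16⟩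
  · rintro j τ ⟨hF, -⟩
    simpa using hF.1.1
  · clear hF h5 h14 h15 h16
    rintro k hk τ h6 ⟨hF, h5, h14, h15, h16⟩
    have hi : (idx 5 6).eval τ = j * n + k := by rw [hF.1.eval_idx (by omega), h5, h6]
    have hbad : badTest.Holds τ ↔ BadPair n σ j k := by
      simp only [badTest, Test.Holds, NatExpr.eval, RealExpr.eval, eval_var, hi, h5, h6, hF.2.2.1,
        hF.2.2.2, BadPair, ← le_antisymm_iff, ne_eq]
    have hsplit : (∀ v < k + 1, ¬ BadPair n σ j v) ↔
        (∀ v < k, ¬ BadPair n σ j v) ∧ ¬ BadPair n σ j k := by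
      constructor
      · exact fun h => ⟨fun v hv => h v (by omega), h k (by omega)⟩
      · rintro ⟨h1, h2⟩ v hv
        rcases Nat.lt_succ_iff_lt_or_eq.1 hv with hv | rfl
        · exact h1 v hv
        · exact h2
    refine Within.cond hy (fun hb => .setNat hy ?_) (fun hb => .skip hy ?_)
    · rw [hbad] at hb
      exact ⟨hFix _ _ _ _ (by norm_num) (by norm_num) (by norm_num) (by norm_num) hF,
        by simpa using h5, by rw [hsplit]; simp [NatExpr.eval, hb], by simpa using h15, by simpa using h16⟩
    · rw [hbad] at hb
      exact ⟨hF, h5, by rw [h14, hsplit]; simp [hb], h15, h16⟩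
  · rintro υ ⟨hF, h5, h14, h15, h16⟩
    refine ⟨hF, h14.trans ?_, h15, h16⟩
    constructor
    · rintro ⟨h1, h2⟩ u hu
      rcases Nat.lt_succ_iff_lt_or_eq.1 hu with hu | rfl
      · exact h1 u hu
      · exact h2
    · exact fun h => ⟨fun u hu => h u (by omega), h j (by omega)⟩

theorem Represents.sum_eq {S : Finset (Fin n)} {a : ℕ → ℕ} (h : Represents S a) :
    ∑ u ∈ Finset.range n, a u = S.card := by
  rw [Finset.sum_range, Finset.sum_congr rfl fun u _ => h u]
  simp

theorem Represents.one_le_iff {S : Finset (Fin n)} {a : ℕ → ℕ} (h : Represents S a) (v : Fin n) :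
    1 ≤ a v ↔ v ∈ S := by
  rw [h v]
  split_ifs with hv <;> simp [hv]

theorem checkProg_spec (hy : 2 ≤ y) (hn : n ≤ y) (hσ : RowsReady n σ) {G : SimpleGraph (Fin n)}
    {w : Sym2 (Fin n) → ℝ≥0} {ρ : ℝ} (hd : DistReady G w ρ σ) (hρ : σ.reals 1 0 = ρ)
    {S S' : Finset (Fin n)} (h2 : Represents S (σ.nats 2)) (h4 : Represents S' (σ.nats 4)) :
    Within y checkProg σ 22 fun τ => (1 ≤ τ.nats 14 0 ↔ IsIndep G w ρ S') ∧
      τ.nats 15 0 = S.card ∧ τ.nats 16 0 = S'.card := by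
  refine (checkProg_loop_spec hy hn hσ).imp ?_
  rintro τ ⟨h14, h15, h16⟩
  refine ⟨h14.trans ?_, h15.trans h2.sum_eq, h16.trans h4.sum_eq⟩
  constructor
  · intro h u hu v hv huv
    have := h u u.2 v v.2
    by_contra! hle
    exact this ⟨(h4.one_le_iff u).2 hu, (h4.one_le_iff v).2 hv, by simpa [Fin.ext_iff] using huv,
      by rw [hρ]; exact (hd u v).2 hle⟩
  · rintro h u hu v hv ⟨h1, h2, h3, h4'⟩
    rw [hρ] at h4'
    have h5 := h ⟨u, hu⟩ ((h4.one_le_iff ⟨u, hu⟩).1 h1) ⟨v, hv⟩ ((h4.one_le_iff ⟨v, hv⟩).1 h2)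
      (by simpa using h3)
    exact absurd ((hd ⟨u, hu⟩ ⟨v, hv⟩).1 h4') (not_le.2 h5)

theorem exists_digits (n : ℕ) (s : ℕ) (g : ℕ → ℕ) (hg : ∀ i, g i < n) :
    ∃ c < n ^ s, ∀ i < s, c / n ^ i % n = g i := by
  induction s generalizing g with
  | zero => exact ⟨0, by simp, by simp⟩
  | succ s ih =>
    obtain ⟨c, hc, h⟩ := ih (fun i => g (i + 1)) (fun i => hg _)
    have hn : 0 < n := (Nat.zero_le _).trans_lt (hg 0)
    refine ⟨n * c + g 0, ?_, ?_⟩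
    · rw [pow_succ']
      have := Nat.mul_le_mul_left n (Nat.succ_le_of_lt hc)
      rw [Nat.mul_succ] at this
      have := hg 0
      omega
    · intro i hi
      match i with
      | 0 => rw [pow_zero, Nat.div_one, Nat.mul_add_mod, Nat.mod_eq_of_lt (hg 0)]
      | i + 1 =>
        rw [pow_succ', ← Nat.div_div_eq_div_mul, Nat.mul_add_div hn, Nat.div_eq_of_lt (hg 0),
          add_zero]
        exact h i (by omega)

/-- List the elements of `D` as digits and pad to length `s` by repeating one of them; this is where
`D` must be nonempty. -/
theorem exists_digitSet_eq {s : ℕ} {D : Finset (Fin n)} (hD : D.Nonempty) (hs : D.card ≤ s) :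
    ∃ c < n ^ s, digitSet n s c = D := by
  obtain ⟨d, hd⟩ := hD
  let g : ℕ → Fin n := fun i => if h : i < D.card then (D.equivFin.symm ⟨i, h⟩ : Fin n) else d
  have hgD : ∀ i, g i ∈ D := by
    intro i
    by_cases h : i < D.card
    · simp only [g, h, dif_pos]
      exact (D.equivFin.symm ⟨i, h⟩).2
    · simpa only [g, h, dif_neg, not_false_eq_true] using hd
  obtain ⟨c, hc, h⟩ := exists_digits n s (fun i => g i) (fun i => (g i).2)
  refine ⟨c, hc, ?_⟩
  ext v
  simp only [digitSet, Finset.mem_filter, Finset.mem_univ, true_and]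
  constructor
  · rintro ⟨i, hi, hv⟩
    rw [h i hi] at hv
    rw [← Fin.ext hv]
    exact hgD i
  · intro hv
    have hlt := (D.equivFin ⟨v, hv⟩).2
    refine ⟨D.equivFin ⟨v, hv⟩, hlt.trans_le hs, ?_⟩
    rw [h _ (hlt.trans_le hs)]
    simp [g]

theorem card_digitSet_le (n s c : ℕ) : (digitSet n s c).card ≤ s := by
  have h : (digitSet n s c).map Fin.valEmbedding ⊆
      (Finset.range s).image fun i => c / n ^ i % n := by
    intro x hx
    obtain ⟨v, hv, rfl⟩ := Finset.mem_map.1 hx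
    obtain ⟨i, hi, h⟩ := (Finset.mem_filter.1 hv).2
    exact Finset.mem_image.2 ⟨i, Finset.mem_range.2 hi, h⟩
  have := (Finset.card_le_card h).trans Finset.card_image_le
  simpa using this

theorem card_sdiff_add_card_sdiff {V : Type*} [DecidableEq V] (S T : Finset V) :
    (S \ T).card + (T \ S).card = (symmDiff S T).card := by
  rw [symmDiff_def, Finset.sup_eq_union, Finset.card_union_of_disjoint]
  exact Finset.disjoint_left.2 fun v h1 h2 => (Finset.mem_sdiff.1 h2).2 (Finset.mem_sdiff.1 h1).1

theorem improves_symmDiff_iff {G : SimpleGraph (Fin n)} {w : Sym2 (Fin n) → ℝ≥0} {ρ : ℝ} {s c : ℕ}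
    {S : Finset (Fin n)} : Improves G w ρ s S (symmDiff S (digitSet n s c)) ↔
      IsIndep G w ρ (symmDiff S (digitSet n s c)) ∧
        S.card < (symmDiff S (digitSet n s c)).card := by
  have : (S \ symmDiff S (digitSet n s c)).card + (symmDiff S (digitSet n s c) \ S).card ≤ s := by
    rw [card_sdiff_add_card_sdiff, symmDiff_symmDiff_cancel_left]
    exact card_digitSet_le n s c
  unfold Improves
  tauto

/-- An improvement changes the cardinality, so the symmetric difference is nonempty; having at most
`s` elements, it has a code. -/
theorem Improves.exists_code {G : SimpleGraph (Fin n)} {w : Sym2 (Fin n) → ℝ≥0} {ρ : ℝ} {s : ℕ}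
    {S S' : Finset (Fin n)} (h : Improves G w ρ s S S') :
    ∃ c < n ^ s, symmDiff S (digitSet n s c) = S' := by
  have hne : (symmDiff S S').Nonempty := by
    rw [Finset.nonempty_iff_ne_empty]
    intro h0
    have : S = S' := symmDiff_eq_bot.1 h0
    exact (this ▸ h.2.1).false
  obtain ⟨c, hc, hD⟩ := exists_digitSet_eq (s := s) hne
    (by rw [← card_sdiff_add_card_sdiff]; exact h.2.2)
  exact ⟨c, hc, by rw [hD, symmDiff_symmDiff_cancel_left]⟩

end Search

/-! ### The search loop and its running time -/

section MainProgram

variable {y n : ℕ} {G : SimpleGraph (Fin n)} {w : Sym2 (Fin n) → ℝ≥0} {ρ : ℝ} {s : ℕ}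

/-- All preprocessing has been done. -/
structure SearchReady (G : SimpleGraph (Fin n)) (w : Sym2 (Fin n) → ℝ≥0) (ρ : ℝ) (s : ℕ)
    (σ : Store) : Prop where
  rows : RowsReady n σ
  dist : DistReady G w ρ σ
  radius : σ.reals 1 0 = ρ
  size : σ.nats 9 0 = s
  codes : σ.nats 10 0 = n ^ s

theorem SearchReady.congr {σ τ : Store} (h : SearchReady G w ρ s σ)
    (hn : ∀ a ∈ [0, 3, 9, 10], τ.nats a = σ.nats a) (hr : ∀ a ∈ [1, 2], τ.reals a = σ.reals a) :
    SearchReady G w ρ s τ := by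
  refine ⟨h.rows.congr (hn 0 (by simp)) (hn 3 (by simp)), ?_, ?_, ?_, ?_⟩
  · unfold DistReady
    rw [hr 2 (by simp)]
    exact h.dist
  · rw [hr 1 (by simp), h.radius]
  · rw [hn 9 (by simp), h.size]
  · rw [hn 10 (by simp), h.codes]

theorem SearchReady.of_agreeOff {σ τ : Store} {p : Prog} (h : SearchReady G w ρ s σ)
    (hp : AgreeOff p σ τ) (hn : ∀ a ∈ [0, 3, 9, 10], a ∉ p.natWrites)
    (hr : ∀ a ∈ [1, 2], a ∉ p.realWrites) : SearchReady G w ρ s τ :=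
  h.congr (fun a ha => hp.1 a (hn a ha)) (fun a ha => hp.2 a (hr a ha))

/-- Try the swap with the code in variable `11`; if it improves the current set, perform it and
start over with code `0`, otherwise go on to the next code. -/
def tryProg : Prog :=
  .seq (copyProg 2 4) (.seq (.setNat 12 (.const 0) (var 11)) (.seq flipProg (.seq checkProg
    (.cond (.conj (.natLe (.const 1) (var 14)) (.natLe (.add (var 15) (.const 1)) (var 16)))
      (.seq (copyProg 4 2) (.setNat 11 (.const 0) (.const 0)))
      (.setNat 11 (.const 0) (.add (var 11) (.const 1)))))))

/-- The invariant of the search: `S` is the current set, and the swaps with codes below `c` do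
not improve it. -/
structure SearchInv (G : SimpleGraph (Fin n)) (w : Sym2 (Fin n) → ℝ≥0) (ρ : ℝ) (s : ℕ)
    (S : Finset (Fin n)) (c : ℕ) (σ : Store) : Prop where
  ready : SearchReady G w ρ s σ
  current : Represents S (σ.nats 2)
  code : σ.nats 11 0 = c
  code_le : c ≤ n ^ s
  reach : Relation.ReflTransGen (Improves G w ρ s) ∅ S
  tried : ∀ c' < c, ¬ Improves G w ρ s S (symmDiff S (digitSet n s c'))

/-- The two outcomes are what termination needs: either the set grows, or it stays and the code
advances. -/
theorem tryProg_spec (hy : 2 ≤ y) (hn0 : 0 < n) (hn : n ≤ y) (hs : s ≤ y) (hN : n ^ s ≤ y)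
    {S : Finset (Fin n)} {c : ℕ} {σ : Store} (hσ : SearchInv G w ρ s S c σ) (hc : c < n ^ s) :
    Within y tryProg σ 26 fun τ => ∃ S' c', SearchInv G w ρ s S' c' τ ∧
      (S.card < S'.card ∨ S' = S ∧ c' = c + 1) := by
  refine Within.seq hy (copyProg_spec hy hn (by norm_num) (by norm_num) (by norm_num) (by norm_num)
    hσ.ready.rows.1).frame (k₂ := 25) ?_
  rintro τ₁ ⟨h4, hf⟩
  have r1 : SearchReady G w ρ s τ₁ := hσ.ready.of_agreeOff hf (by decide) (by decide)
  have c1 : τ₁.nats 11 0 = c := by rw [hf.1 11 (by decide), hσ.code]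
  have s1 : Represents S (τ₁.nats 2) := by rw [hf.1 2 (by decide)]; exact hσ.current
  have t1 : Represents S (τ₁.nats 4) := fun v => by rw [h4 v v.2]; exact hσ.current v
  clear h4 hf
  refine Within.seq hy (Q' := fun τ => SearchReady G w ρ s τ ∧ τ.nats 11 0 = c ∧
    Represents S (τ.nats 2) ∧ Represents S (τ.nats 4) ∧ τ.nats 12 0 = c)
    (.setNat hy ⟨r1.congr ?_ (fun _ _ => rfl), by simpa using c1, by simpa [Represents] using s1,
      by simpa [Represents] using t1, by simpa [NatExpr.eval] using c1⟩) (k₂ := 24) ?_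
  · intro a ha
    ext j
    have : a ≠ 12 := by rintro rfl; simp at ha
    simp [this]
  clear r1 c1 s1 t1
  rintro τ₂ ⟨r2, c2, s2, t2, d2⟩
  refine Within.seq hy (flipProg_spec hy hn0 hs (hc.le.trans hN) r2.rows.1 r2.size d2 s2 t2).frame
    (k₂ := 23) ?_
  rintro τ₃ ⟨t3, hf⟩
  have r3 : SearchReady G w ρ s τ₃ := r2.of_agreeOff hf (by decide) (by decide)
  have c3 : τ₃.nats 11 0 = c := by rw [hf.1 11 (by decide), c2]
  have s3 : Represents S (τ₃.nats 2) := by rw [hf.1 2 (by decide)]; exact s2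
  clear hf
  refine Within.seq hy (checkProg_spec hy hn r3.rows r3.dist r3.radius s3 t3).frame
    (k₂ := 13) ?_
  rintro τ₄ ⟨⟨h14, h15, h16⟩, hf⟩
  have r4 : SearchReady G w ρ s τ₄ := r3.of_agreeOff hf (by decide) (by decide)
  have c4 : τ₄.nats 11 0 = c := by rw [hf.1 11 (by decide), c3]
  have s4 : Represents S (τ₄.nats 2) := by rw [hf.1 2 (by decide)]; exact s3
  have t4 : Represents (symmDiff S (digitSet n s c)) (τ₄.nats 4) := by
    rw [hf.1 4 (by decide)]; exact t3
  clear hf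
  refine Within.cond (k := 12) hy (fun hb => ?_) (fun hb => ?_)
  · simp only [Test.Holds, NatExpr.eval, eval_var, h14, h15, h16, Nat.succ_le_iff] at hb
    have himp : Improves G w ρ s S (symmDiff S (digitSet n s c)) := improves_symmDiff_iff.2 hb
    refine Within.seq hy (copyProg_spec hy hn (by norm_num) (by norm_num) (by norm_num)
      (by norm_num) r4.rows.1).frame (k₂ := 6) ?_
    rintro τ₅ ⟨h2, hf⟩
    have r5 : SearchReady G w ρ s τ₅ := r4.of_agreeOff hf (by decide) (by decide)
    refine .setNat hy ⟨_, 0, ⟨r5.congr ?_ (fun _ _ => rfl), fun v => ?_, by simp [NatExpr.eval],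
      Nat.zero_le _, hσ.reach.tail himp, by simp⟩, Or.inl himp.2.1⟩
    · intro a ha
      ext j
      have : a ≠ 11 := by rintro rfl; simp at ha
      simp [this]
    · have := t4 v
      rw [← h2 v v.2] at this
      simpa using this
  · simp only [Test.Holds, NatExpr.eval, eval_var, h14, h15, h16, Nat.succ_le_iff] at hb
    have himp : ¬ Improves G w ρ s S (symmDiff S (digitSet n s c)) :=
      fun h => hb (improves_symmDiff_iff.1 h)
    refine Within.mono hy (.setNat hy ⟨S, c + 1, ⟨r4.congr ?_ (fun _ _ => rfl), ?_, ?_, hc,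
      hσ.reach, ?_⟩, Or.inr ⟨rfl, rfl⟩⟩) (by norm_num : 6 ≤ 12)
    · intro a ha
      ext j
      have : a ≠ 11 := by rintro rfl; simp at ha
      simp [this]
    · simpa [Represents] using s4
    · simp [NatExpr.eval, c4]
    · intro c' hc'
      rcases Nat.lt_succ_iff_lt_or_eq.1 hc' with hc' | rfl
      · exact hσ.tried c' hc'
      · exact himp

theorem Represents.outputSet_eq {S : Finset (Fin n)} {σ : Store} (h : Represents S (σ.nats 2)) :
    outputSet n σ = S := by
  ext v
  simp only [outputSet, Finset.mem_filter, Finset.mem_univ, true_and, h v]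
  split_ifs with hv <;> simp [hv]

/-- The local search, after preprocessing. -/
def searchProg : Prog :=
  .seq (.setNat 11 (.const 0) (.const 0)) (.loop (.natLe (.add (var 11) (.const 1)) (var 10)) tryProg)

theorem searchProg_spec (hy : 2 ≤ y) (hn0 : 0 < n) (hn : n ≤ y) (hs : s ≤ y) (hN : n ^ s ≤ y)
    {σ : Store} (hσ : SearchReady G w ρ s σ) (h2 : ∀ v, σ.nats 2 v = 0) :
    Within y searchProg σ 32 fun τ => IsLocalSearchOutput G w ρ s (outputSet n τ) := by
  refine Within.seq hy (Q' := SearchInv G w ρ s ∅ 0)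
    (.setNat hy ⟨hσ.congr ?_ (fun _ _ => rfl), ?_, by simp [NatExpr.eval], Nat.zero_le _, .refl,
      by simp⟩) (k₂ := 31) ?_
  · intro a ha
    ext j
    have : a ≠ 11 := by rintro rfl; simp at ha
    simp [this]
  · intro v
    simp [h2]
  intro τ hτ
  -- The measure is lexicographic. Resetting the code costs at most `n ^ s`, less than the `n ^ s +
  -- 1` gained when the set grows. Initially it is at most `y (y + 1) + y ≤ y ^ 3`.
  refine (Within.loop hy (a := 3) (k := 26) (fun τ => ∃ S c, SearchInv G w ρ s S c τ)
    (fun τ => (n - (outputSet n τ).card) * (n ^ s + 1) + (n ^ s - τ.nats 11 0)) ⟨_, _, hτ⟩ ?_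
    ?_).imp ?_
  · rw [hτ.current.outputSet_eq, hτ.code, Finset.card_empty, Nat.sub_zero, Nat.sub_zero]
    have h1 : n * (n ^ s + 1) ≤ y * (y + 1) := Nat.mul_le_mul hn (by omega)
    have h3 : 2 * (y * y) ≤ y ^ 3 := by
      rw [pow_succ, pow_two, mul_comm]
      exact Nat.mul_le_mul_left _ hy
    have h4 := Nat.mul_le_mul_right y hy
    rw [mul_add y, mul_one] at h1
    omega
  · rintro υ ⟨S, c, hυ⟩ hb
    simp only [Test.Holds, NatExpr.eval, eval_var, hυ.code, hυ.ready.codes, Nat.succ_le_iff] at hb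
    refine (tryProg_spec hy hn0 hn hs hN hυ hb).imp ?_
    rintro φ ⟨S', c', hφ, h⟩
    refine ⟨⟨S', c', hφ⟩, ?_⟩
    rw [hφ.current.outputSet_eq, hφ.code, hυ.current.outputSet_eq, hυ.code]
    rcases h with h | ⟨rfl, rfl⟩
    · have h1 : S'.card ≤ n := by simpa using Finset.card_le_univ S'
      have h3 : n - S'.card + 1 ≤ n - S.card := by omega
      have h4 := Nat.mul_le_mul_right (n ^ s + 1) h3
      rw [add_mul, one_mul] at h4
      omega
    · omega
  · rintro υ ⟨⟨S, c, hυ⟩, hb⟩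
    simp only [Test.Holds, NatExpr.eval, eval_var, hυ.code, hυ.ready.codes, Nat.succ_le_iff] at hb
    rw [hυ.current.outputSet_eq]
    -- When the loop stops, all codes below `n ^ s` have been tried on the current set, and every
    -- conceivable improvement has such a code.
    refine ⟨hυ.reach, fun S' h => ?_⟩
    obtain ⟨c', hc', rfl⟩ := h.exists_code
    exact hυ.tried c' (by omega) h

/-- The local search with swap size `⌈K / ε ^ 2⌉`. -/
def localSearchProg (K : ℕ) : Prog :=
  .seq rowProg (.seq initProg (.seq distProg (.seq (sizeProg K) (.seq powProg searchProg))))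

theorem tableEntry_index {α : Type*} [Zero α] (f : Fin n → Fin n → α) (u v : Fin n) :
    tableEntry n f (u * n + v) = f u v := by
  have hlt : (u : ℕ) * n + v < n * n := by
    have := Nat.mul_le_mul_right n (Nat.succ_le_of_lt u.2)
    rw [Nat.succ_mul] at this
    omega
  have hdiv : ((u : ℕ) * n + v) / n = u := by
    rw [mul_comm, Nat.mul_add_div (by omega), Nat.div_eq_of_lt v.2, add_zero]
  have hmod : ((u : ℕ) * n + v) % n = v := by
    rw [mul_comm, Nat.mul_add_mod, Nat.mod_eq_of_lt v.2]
  rw [tableEntry, dif_pos hlt]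
  simp only [hdiv, hmod]

theorem localSearchProg_spec (hy : 2 ≤ y) (hG : G.Connected) {ε : ℝ} (hρ : 0 < ρ) (hε : 0 < ε)
    (K : ℕ) (hn : n ≤ y) (hs : ⌈(K : ℝ) / ε ^ 2⌉₊ ≤ y) (hN : n ^ ⌈(K : ℝ) / ε ^ 2⌉₊ ≤ y) :
    Within y (localSearchProg K) (inputStore n G w ρ ε) 37 fun τ =>
      IsLocalSearchOutput G w ρ ⌈(K : ℝ) / ε ^ 2⌉₊ (outputSet n τ) := by
  classical
  have hn0 : 0 < n := by
    obtain ⟨v⟩ := hG.nonempty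
    exact (Nat.zero_le _).trans_lt v.2
  set σ := inputStore n G w ρ ε with hσ
  have i0 : σ.nats 0 0 = n := by simp [hσ, inputStore]
  have i1 : ∀ u v : Fin n, σ.nats 1 (u * n + v) = if G.Adj u v then 1 else 0 := by
    intro u v
    simp [hσ, inputStore, tableEntry_index]
  have i2 : ∀ v, σ.nats 2 v = 0 := by simp [hσ, inputStore]
  have i3 : σ.nats 3 0 = 0 := by simp [hσ, inputStore]
  have w0 : ∀ u v : Fin n, σ.reals 0 (u * n + v) = if G.Adj u v then (w s(u, v) : ℝ) else 0 := by
    intro u v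
    simp [hσ, inputStore, tableEntry_index]
  have w1 : σ.reals 1 0 = ρ := by simp [hσ, inputStore]
  have w2 : σ.reals 1 1 = ε := by simp [hσ, inputStore]
  clear_value σ
  refine Within.seq hy (rowProg_spec hy hn i0 i3).frame (k₂ := 36) ?_
  rintro τ₁ ⟨r1, hf1, hf1'⟩
  refine Within.seq hy (initProg_spec hy hn r1).frame (k₂ := 35) ?_
  rintro τ₂ ⟨hD, hf2, hf2'⟩
  have r2 : RowsReady n τ₂ := r1.congr (hf2 0 (by decide)) (hf2 3 (by decide))
  have hentry : ∀ u v : Fin n, τ₂.reals 2 (u * n + v) =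
      if u = v then 0 else if G.Adj u v then (w s(u, v) : ℝ) else ρ + 1 := by
    intro u v
    rw [hD u u.2 v v.2, initEntry, hf1 1 (by decide), hf1' 0 (by decide), hf1' 1 (by decide), i1, w0,
      w1]
    by_cases huv : u = v
    · simp [huv]
    · by_cases hadj : G.Adj u v <;> simp [huv, hadj, Fin.val_inj]
  refine Within.seq hy (distProg_spec hy hn hG hρ r2 (w := w) (fun u => ?_) (fun u v huv => ?_)
    (fun u v huv hadj => ?_)).frame (k₂ := 34) ?_
  · rw [hentry, if_pos rfl]
  · rw [hentry, if_neg huv.ne, if_pos huv]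
  · rw [hentry, if_neg huv, if_neg hadj]
  rintro τ₃ ⟨d3, hf3, hf3'⟩
  refine Within.seq hy (sizeProg_spec hy K hε (σ := τ₃) ?_ hs).frame (k₂ := 33) ?_
  · rw [hf3' 1 (by decide), hf2' 1 (by decide), hf1' 1 (by decide), w2]
  rintro τ₄ ⟨s4, hf4, hf4'⟩
  have n4 : ∀ a ∉ [9], τ₄.nats a = τ₃.nats a :=
    fun a ha => hf4 a (by simpa [sizeProg, Prog.natWrites] using ha)
  have m4 : ∀ a ∉ [3], τ₄.reals a = τ₃.reals a :=
    fun a ha => hf4' a (by simpa [sizeProg, Prog.realWrites] using ha)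
  refine Within.seq hy (powProg_spec hy hn hs (σ := τ₄) ?_ s4).frame (k₂ := 32) ?_
  · rw [n4 0 (by decide), hf3 0 (by decide), r2.1]
  rintro τ₅ ⟨p5, hf5, hf5'⟩
  refine searchProg_spec hy hn0 hn hs hN ⟨?_, ?_, ?_, ?_, p5⟩ ?_
  · exact r2.congr (by rw [hf5 0 (by decide), n4 0 (by decide), hf3 0 (by decide)])
      (by rw [hf5 3 (by decide), n4 3 (by decide), hf3 3 (by decide)])
  · unfold DistReady
    rw [hf5' 2 (by decide), m4 2 (by decide)]
    exact d3
  · rw [hf5' 1 (by decide), m4 1 (by decide), hf3' 1 (by decide), hf2' 1 (by decide),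
      hf1' 1 (by decide), w1]
  · rw [hf5 9 (by decide), s4]
  · intro v
    rw [hf5 2 (by decide), n4 2 (by decide), hf3 2 (by decide), hf2 2 (by decide),
      hf1 2 (by decide), i2]

/-- The local search halts within the claimed time. -/
theorem localSearchProg_runs (hG : G.Connected) {ε : ℝ} (hρ : 0 < ρ) (hε : 0 < ε)
    (hε2 : ε < 1 / 2) (K : ℕ) :
    ∃ (τ : Store) (t : ℕ), Runs (localSearchProg K) (inputStore n G w ρ ε) τ t ∧
      (t : ℝ) ≤ ((max n 2 : ℕ) : ℝ) ^ (((37 * (K + 1) : ℕ) : ℝ) / ε ^ 2) ∧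
      IsLocalSearchOutput G w ρ ⌈(K : ℝ) / ε ^ 2⌉₊ (outputSet n τ) := by
  set s := ⌈(K : ℝ) / ε ^ 2⌉₊ with hs
  set M := max n 2 with hM
  have hM2 : 2 ≤ M := le_max_right _ _
  have hnM : n ≤ M := le_max_left _ _
  have hpow : M ^ s ≤ M ^ (s + 1) := Nat.pow_le_pow_right (by omega) (Nat.le_succ s)
  have hself : M ≤ M ^ (s + 1) := Nat.le_self_pow (Nat.succ_ne_zero s) M
  -- The base `M ^ (s + 1)` dominates `2`, `n`, `s` and `n ^ s` simultaneously, as all the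
  -- specifications require.
  obtain ⟨τ, t, hr, ht, hout⟩ := localSearchProg_spec (y := M ^ (s + 1)) (w := w)
    (hM2.trans hself) hG hρ hε K (hnM.trans hself)
    ((Nat.lt_pow_self (by omega : 1 < M)).le.trans hpow)
    ((Nat.pow_le_pow_left hnM s).trans hpow)
  refine ⟨τ, t, hr, ?_, hout⟩
  have h1 : (t : ℝ) ≤ (M : ℝ) ^ (((s + 1) * 37 : ℕ) : ℝ) := by
    rw [Real.rpow_natCast, pow_mul]
    exact_mod_cast ht
  refine h1.trans (Real.rpow_le_rpow_of_exponent_le (by exact_mod_cast (by omega : 1 ≤ M)) ?_)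
  have hε0 : 0 < ε ^ 2 := by positivity
  have h2 : (s : ℝ) < K / ε ^ 2 + 1 := Nat.ceil_lt_add_one (by positivity)
  -- The exponent is `37 (s + 1)` with `s + 1 < K / ε ^ 2 + 2`. As `ε < 1 / 2`, the summand `2` is
  -- absorbed by another `1 / ε ^ 2`, hence `K + 1` in the constant.
  have h3 : 2 ≤ 1 / ε ^ 2 := by
    rw [le_div_iff₀ hε0]
    nlinarith
  have h4 : ((37 * (K + 1) : ℕ) : ℝ) / ε ^ 2 = 37 * (K / ε ^ 2 + 1 / ε ^ 2) := by
    push_cast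
    ring
  rw [h4]
  push_cast
  linarith

end MainProgram

end LocalSearch

theorem mainTheorem11 (h : ℕ) :
    -- swap constant, exponent constant and program depend on the number of vertices of `H` only
    ∃ (K T : ℕ) (P : LocalSearch.Prog),
      ∀ (H : SimpleGraph (Fin h)) (n : ℕ) (G : SimpleGraph (Fin n)) (w : Sym2 (Fin n) → NNReal)
        (ρ ε : ℝ),
        G.Connected → LocalSearch.MinorFree H G → 0 < ρ → 0 < ε → ε < 1 / 2 →
        -- every output of the local search is a near-optimal independent set
        (∀ S : Finset (Fin n),
          LocalSearch.IsLocalSearchOutput G w ρ ⌈(K : ℝ) / ε ^ 2⌉₊ S →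
            LocalSearch.IsIndep G w ρ S ∧
            ∀ S' : Finset (Fin n), LocalSearch.IsIndep G w ρ S' →
              (1 - ε) * (S'.card : ℝ) ≤ (S.card : ℝ)) ∧
        -- the program halts in time, and what it returns is an output of the local search
        (∃ (τ : LocalSearch.Store) (t : ℕ),
          LocalSearch.Runs P (LocalSearch.inputStore n G w ρ ε) τ t ∧
          (t : ℝ) ≤ ((max n 2 : ℕ) : ℝ) ^ ((T : ℝ) / ε ^ 2) ∧
          LocalSearch.IsLocalSearchOutput G w ρ ⌈(K : ℝ) / ε ^ 2⌉₊
            (LocalSearch.outputSet n τ) ∧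
          LocalSearch.IsIndep G w ρ (LocalSearch.outputSet n τ) ∧
          ∀ S' : Finset (Fin n), LocalSearch.IsIndep G w ρ S' →
            (1 - ε) * (S'.card : ℝ) ≤ ((LocalSearch.outputSet n τ).card : ℝ)) := by
  refine ⟨LocalSearch.swapConst h, 37 * (LocalSearch.swapConst h + 1),
    LocalSearch.localSearchProg (LocalSearch.swapConst h), ?_⟩
  intro H n G w ρ ε hG hH hρ hε hε2
  have hopt : ∀ S : Finset (Fin n),
      LocalSearch.IsLocalSearchOutput G w ρ ⌈(LocalSearch.swapConst h : ℝ) / ε ^ 2⌉₊ S →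
        LocalSearch.IsIndep G w ρ S ∧ ∀ S' : Finset (Fin n), LocalSearch.IsIndep G w ρ S' →
          (1 - ε) * (S'.card : ℝ) ≤ (S.card : ℝ) :=
    fun S hS => ⟨hS.isIndep, fun S' hS' =>
      LocalSearch.card_le_of_locallyOptimal hG hH hε hε2 hS.isIndep hS.2 hS'⟩
  obtain ⟨τ, t, hr, ht, hout⟩ := LocalSearch.localSearchProg_runs (w := w) hG hρ hε hε2
    (LocalSearch.swapConst h)
  exact ⟨hopt, τ, t, hr, ht, hout, hopt _ hout⟩
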